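/- Let $B(\underline v,r)\subset\mathbb{C}^2$ denote the open Euclidean ball. For $H\ge0$, $K\ge1$ write $\mathcal B\in\mathrm{Car}_{2,0}(H,K)$ if $\mathcal B\subset\mathbb C^2$ is covered by at most $K$ balls of radius $e^{-H}$. For $f$ analytic on $B(0,1)$, $\underline v_0\in B(0,1/4)$ and $0<R\le 1/4$ let $M_f(\underline v_0,R)=\sup_{B(\underline v_0,R)}\log|f|$, let $B_f(\tfrac14;\underline v_0,R)=M_f(\underline v_0,R)-M_f(\underline v_0,R/4)$ (defined as $0$ if $f\equiv0$), and let $B_f(\tfrac14)$ be the supremum of $B_f(\tfrac14;\underline v_0,R)$ over all such $\underline v_0$ and $R$. Theorem C. There is an absolute constant $C\ge1$ such that the following holds. Let $f_1,f_2$ be analytic on $B(0,1)\subset\mathbb C^2$ with $\sup_{B(0,1)}\log|f_i|\le 0$ for $i=1,2$; let $F=(f_1,f_2)$, $|F|=(|f_1|^2+|f_2|^2)^{1/2}$, $\mathcal N_F(\epsilon)=\{\underline v\in B(0,1):|F(\underline v)|<\epsilon\}$ and $B_0=\max_i B_{f_i}(\tfrac14)$, and assume $B_0\ge1$. Suppose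 the transversality condition holds: for some $H_0,H_1,K_1$ with $K_1\ge1$, $$\mathcal N_F(\exp(-H_0))\cap B(0,1/2)\in\mathrm{Car}_{2,0}(H_1,K_1),\qquad H_0\ge C H_1,\quad H_1\ge C B_0,\quad H_1\ge C\log K_1 .$$ Then for every $H\ge C$, $$\mathcal N_F(\exp(-HB_0^2H_0))\cap B(0,1/4)\in\mathrm{Car}_{2,0}(H,K)\quad\text{for some } K\le C\,K_1B_0^2H_0^2,$$ that is, this set is covered by at most $C K_1B_0^2H_0^2$ balls of radius $e^{-H}$. -/

import Mathlib

open Set Metric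

/-- `ℂ²` with its Euclidean norm. -/
abbrev C2 : Type := EuclideanSpace ℂ (Fin 2)

/-- `M_f(v, R) = sup_{B(v, R)} log |f|`, with `log 0 = -∞`. -/
noncomputable def supLog (f : C2 → ℂ) (v : C2) (R : ℝ) : EReal :=
  ⨆ x ∈ ball v R, ENNReal.log ‖f x‖ₑ

open Classical in
/-- The Bernstein exponent `B_f(μ; v, R) = M_f(v, R) - M_f(v, μ R)`, set to `0` if `f` vanishes
identically on the ball. -/
noncomputable def bernsteinExp (f : C2 → ℂ) (μ : ℝ) (v : C2) (R : ℝ) : EReal :=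
  if ∀ x ∈ ball v R, f x = 0 then 0 else supLog f v R - supLog f v (μ * R)

/-- `B_f(μ)`: the supremum of `B_f(μ; v, R)` over `v ∈ B(0, 1/4)` and `0 < R ≤ 1/4`. -/
noncomputable def bernsteinSup (f : C2 → ℂ) (μ : ℝ) : EReal :=
  ⨆ v ∈ ball (0 : C2) (1 / 4), ⨆ R ∈ Ioc (0 : ℝ) (1 / 4), bernsteinExp f μ v R

/-- `S ∈ Car_{2,0}(H, K)`: `S` is covered by at most `K` balls of radius `e^{-H}`,
where `H ≥ 0` and `K ≥ 1`. -/
def IsCar20 (H K : ℝ) (S : Set C2) : Prop :=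
  0 ≤ H ∧ 1 ≤ K ∧
    ∃ (n : ℕ) (c : Fin n → C2), (n : ℝ) ≤ K ∧ S ⊆ ⋃ j, ball (c j) (Real.exp (-H))

/-- The sublevel set `{v ∈ B(0, 1) : |F(v)| < ε}` of `F = (f₁, f₂)`, where
`|F|` is the Euclidean norm. -/
noncomputable def smallSet (f₁ f₂ : C2 → ℂ) (ε : ℝ) : Set C2 :=
  {v | v ∈ ball (0 : C2) 1 ∧ ‖(!₂[f₁ v, f₂ v] : C2)‖ < ε}

/-- The transversality condition for `F = (f₁, f₂)` with parameters `B₀, H₀, H₁, K₁`, where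
`a ≫ b` is read as `a ≥ C * b`. -/
structure Transversal (C : ℝ) (f₁ f₂ : C2 → ℂ) (B₀ H₀ H₁ K₁ : ℝ) : Prop where
  analytic₁ : AnalyticOnNhd ℂ f₁ (ball 0 1)
  analytic₂ : AnalyticOnNhd ℂ f₂ (ball 0 1)
  normalized₁ : supLog f₁ 0 1 ≤ 0
  normalized₂ : supLog f₂ 0 1 ≤ 0
  bernstein : (B₀ : EReal) = max (bernsteinSup f₁ (1 / 4)) (bernsteinSup f₂ (1 / 4))
  H₁_large : C * B₀ ≤ H₁
  H₀_large : C * H₁ ≤ H₀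
  log_K₁_small : C * Real.log K₁ ≤ H₁
  car : IsCar20 H₁ K₁ (smallSet f₁ f₂ (Real.exp (-H₀)) ∩ ball 0 (1 / 2))

/-! The set to be covered lies in the `N ≤ K₁` balls of radius `exp (-H₁)` given by transversality,
so it suffices to cover its part in one such ball by at most `B₀ ^ 2 * H₀ ^ 2` balls of radius `exp
(-H)`. Let `v` be a point of that part.

A pigeonhole among parallel fibres (`exists_fibre_avoiding_balls`) gives a point near `v` outside
all the balls. There `|F| ≥ exp (-H₀)`, so one of the functions, say `f₁`, is not too small. The
Bernstein bound, used at three successive scales, makes `f₁` comparable, up to `exp (-O(B₀))`, to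
its bound `S` on `ball v (1 / 4)` at some point very near `v`. A Cartan estimate on the complex line
through `v` and that point gives a circle on which `f₁` is bounded below, and the bound persists on
parallel or slightly tilted lines (`exists_circle_norm_ge`, `norm_ge_of_circle`).

Hence `f₁` has a constant number `d = O(B₀)` of zeros inside the circle on each such line, and the
resultant of `f₁, f₂` in the line variable is a holomorphic function of the transversal variable `z`
(`exists_resultant`). On a fibre missing all the balls, `f₂` is at least `exp (-H₀)` at the zeros of
`f₁`, so the normalised resultant is at least `exp (-O(B₀ * H₀))` there. Where both functions are
tiny the resultant is tiny, and Cartan's estimate then confines `z` to small discs about `n = O(B₀ *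
H₀ / H₁)` points (`exists_finite_projection`). The gain of `H₁` comes from the ratio between the
disc where the resultant lives and the much smaller scale of the balls.

Two slightly different projections, each confined to few small discs, determine the point up to `exp
(-H)`; the pairs of disc centres give the local cover (`exists_local_cover`). -/

/-! ### One-variable estimates of Cartan and Harnack type. -/

/-- A product of `n` distances to points of the line is at least `(ℓ / 2) ^ n` somewhere on an
interval of length `2 * ℓ`. -/
theorem exists_prod_abs_sub_ge {n : ℕ} (x : Fin n → ℝ) (α : ℝ) {l : ℝ} (hl : 0 < l) :
    ∃ r ∈ Icc (α - l) (α + l), (l / 2) ^ n ≤ ∏ i, |r - x i| := by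
  rcases Nat.eq_zero_or_pos n with rfl | hn
  · exact ⟨α, ⟨by linarith, by linarith⟩, by simp⟩
  by_contra! hcon
  -- After rescaling to `[-1, 1]`, the polynomial `2 ^ n * Q` would be bounded by `1` with leading
  -- coefficient `2 ^ n`, against Chebyshev's bound `2 ^ (n - 1)`.
  set Q : Polynomial ℝ := ∏ i, (Polynomial.X - Polynomial.C ((x i - α) / l)) with hQ
  have hQm : Q.Monic := Polynomial.monic_prod_of_monic _ _ fun i _ => Polynomial.monic_X_sub_C _
  have hQd : Q.natDegree = n := by
    rw [hQ, Polynomial.natDegree_prod_of_monic _ _ fun i _ => Polynomial.monic_X_sub_C _]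
    simp
  have hev : ∀ y ∈ Icc (-1 : ℝ) 1, |(Polynomial.C ((2 : ℝ) ^ n) * Q).eval y| ≤ 1 := by
    intro y hy
    have h1 := hcon (α + l * y) ⟨by nlinarith [hy.1], by nlinarith [hy.2]⟩
    have h2 : ∏ i, |α + l * y - x i| = l ^ n * |Q.eval y| := by
      rw [hQ, Polynomial.eval_prod, Finset.abs_prod]
      have : l ^ n = ∏ _i : Fin n, l := by simp
      rw [this, ← Finset.prod_mul_distrib]
      refine Finset.prod_congr rfl fun i _ => ?_
      rw [← abs_of_pos hl, ← abs_mul, abs_of_pos hl]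
      congr 1
      simp only [Polynomial.eval_sub, Polynomial.eval_X, Polynomial.eval_C]
      field_simp
      ring
    rw [h2, div_pow, div_eq_mul_inv] at h1
    have h3 : |Q.eval y| < (2 ^ n)⁻¹ := lt_of_mul_lt_mul_left h1 (by positivity)
    rw [Polynomial.eval_mul, Polynomial.eval_C, abs_mul, abs_of_pos (by positivity)]
    calc (2 : ℝ) ^ n * |Q.eval y| ≤ 2 ^ n * (2 ^ n)⁻¹ := by gcongr
      _ = 1 := by field_simp
  have hdeg : (Polynomial.C ((2 : ℝ) ^ n) * Q).degree ≤ n := by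
    rw [Polynomial.degree_C_mul (by positivity), ← hQd]
    exact Polynomial.degree_le_natDegree
  have := Polynomial.Chebyshev.coeff_le_of_forall_abs_le_one hdeg hev
  rw [Polynomial.coeff_C_mul] at this
  nth_rw 2 [← hQd] at this
  rw [Polynomial.coeff_natDegree, hQm.leadingCoeff, mul_one] at this
  exact absurd this (not_le.2 (pow_lt_pow_right₀ (by norm_num) (by omega)))

/-- A bound for the cofactor of a finite product of linear factors. -/
theorem norm_cofactor_le {s q S : ℝ} {g u : ℂ → ℂ} {n : ℕ} {Z : Fin n → ℂ}
    (hqs : q < s) (hu : DifferentiableOn ℂ u (ball 0 s))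
    (hg : ∀ w ∈ ball (0 : ℂ) s, ‖g w‖ ≤ S) (hZ : ∀ i, ‖Z i‖ ≤ q)
    (hfac : ∀ w ∈ ball (0 : ℂ) s, g w = (∏ i, (w - Z i)) * u w) {w : ℂ} (hw : w ∈ ball 0 s) :
    ‖u w‖ ≤ S / (s - q) ^ n := by
  have hw' : ‖w‖ < s := by simpa using hw
  have hs0 : 0 < s := (norm_nonneg w).trans_lt hw'
  have hS0 : 0 ≤ S := (norm_nonneg _).trans (hg w hw)
  -- On the circle of radius `r` every factor is at least `r - q`, so the maximum principle bounds
  -- `u`. Since `g` is controlled only on the open disc, `r` tends to `s` afterwards.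
  have key : ∀ r : ℝ, max ‖w‖ (max q 0) < r → r < s → ‖u w‖ * (r - q) ^ n ≤ S := by
    intro r hr hrs
    have hr0 : 0 < r := lt_of_le_of_lt ((le_max_right _ _).trans (le_max_right _ _)) hr
    have hwr : ‖w‖ < r := lt_of_le_of_lt (le_max_left _ _) hr
    have hqr : q < r := lt_of_le_of_lt ((le_max_left _ _).trans (le_max_right _ _)) hr
    have hpos : 0 < (r - q) ^ n := pow_pos (by linarith) n
    rw [← le_div_iff₀ hpos]
    have hcl : closedBall (0 : ℂ) r ⊆ ball 0 s := closedBall_subset_ball hrs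
    refine Complex.norm_le_of_forall_mem_frontier_norm_le (U := ball 0 r) isBounded_ball
      (DifferentiableOn.diffContOnCl (hu.mono ?_)) ?_ ?_
    · rw [closure_ball _ hr0.ne']; exact hcl
    · intro v hv
      rw [frontier_ball _ hr0.ne'] at hv
      have hvs : v ∈ ball (0 : ℂ) s := hcl (sphere_subset_closedBall hv)
      have hvr : ‖v‖ = r := by simpa using hv
      rw [le_div_iff₀ hpos]
      have h1 := hg v hvs
      rw [hfac v hvs, norm_mul, norm_prod, mul_comm] at h1
      refine le_trans ?_ h1
      gcongr
      calc (r - q) ^ n = ∏ _i : Fin n, (r - q) := by simp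
        _ ≤ ∏ i, ‖v - Z i‖ := by
          refine Finset.prod_le_prod (fun _ _ => by linarith) fun i _ => ?_
          have := norm_sub_norm_le v (Z i)
          linarith [hZ i]
    · apply subset_closure; simpa using hwr
  have hpos : 0 < (s - q) ^ n := pow_pos (by linarith) n
  rw [le_div_iff₀ hpos]
  have hcont : Filter.Tendsto (fun r : ℝ => ‖u w‖ * (r - q) ^ n) (nhdsWithin s (Iio s))
      (nhds (‖u w‖ * (s - q) ^ n)) := by
    apply Filter.Tendsto.mono_left _ nhdsWithin_le_nhds
    exact Continuous.tendsto (by fun_prop) s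
  refine le_of_tendsto hcont ?_
  have : Ioo (max ‖w‖ (max q 0)) s ∈ nhdsWithin s (Iio s) :=
    Ioo_mem_nhdsLT (max_lt hw' (max_lt hqs hs0))
  filter_upwards [this] with r hr using key r hr.1 hr.2

/-- A value of a product with `n` linear factors is geometrically small in `n`. -/
theorem norm_le_geometric {s q S : ℝ} {g u : ℂ → ℂ} {n : ℕ} {Z : Fin n → ℂ}
    (hqs : q < s) (hu : DifferentiableOn ℂ u (ball 0 s))
    (hg : ∀ w ∈ ball (0 : ℂ) s, ‖g w‖ ≤ S) (hZ : ∀ i, ‖Z i‖ ≤ q)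
    (hfac : ∀ w ∈ ball (0 : ℂ) s, g w = (∏ i, (w - Z i)) * u w) {w : ℂ} (hw : w ∈ ball 0 s) :
    ‖g w‖ ≤ S * ((‖w‖ + q) / (s - q)) ^ n := by
  have h1 := norm_cofactor_le hqs hu hg hZ hfac hw
  have hpos : 0 < (s - q) ^ n := pow_pos (by linarith) n
  rw [hfac w hw, norm_mul, norm_prod]
  have h2 : ∏ i, ‖w - Z i‖ ≤ (‖w‖ + q) ^ n := by
    calc ∏ i, ‖w - Z i‖ ≤ ∏ _i : Fin n, (‖w‖ + q) :=
          Finset.prod_le_prod (fun _ _ => norm_nonneg _) fun i _ =>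
            (norm_sub_le _ _).trans (by linarith [hZ i])
      _ = (‖w‖ + q) ^ n := by simp
  have h3 : 0 ≤ ∏ i, ‖w - Z i‖ := Finset.prod_nonneg fun _ _ => norm_nonneg _
  calc (∏ i, ‖w - Z i‖) * ‖u w‖ ≤ (‖w‖ + q) ^ n * (S / (s - q) ^ n) :=
        mul_le_mul h2 h1 (norm_nonneg _) (h3.trans h2)
    _ = _ := by rw [div_pow]; ring

/-- Splitting off all zeros in a closed disc. -/
theorem exists_zero_factorization {s q S : ℝ} {g : ℂ → ℂ} {a : ℂ}
    (hqs : q < s) (hg : DifferentiableOn ℂ g (ball 0 s))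
    (hb : ∀ w ∈ ball (0 : ℂ) s, ‖g w‖ ≤ S) (ha : ‖a‖ + q < s - q) (hq : 0 ≤ q) (hga : g a ≠ 0) :
    ∃ (n : ℕ) (Z : Fin n → ℂ) (u : ℂ → ℂ), DifferentiableOn ℂ u (ball 0 s) ∧
      (∀ i, ‖Z i‖ ≤ q) ∧ (∀ w ∈ ball (0 : ℂ) s, g w = (∏ i, (w - Z i)) * u w) ∧
      ∀ w, ‖w‖ ≤ q → u w ≠ 0 := by
  classical
  -- If zeros could be split off forever, `norm_le_geometric` at `a` with ratio `(‖a‖ + q) / (s - q)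
  -- < 1` would force `g a = 0`.
  by_contra! hcon
  have has : a ∈ ball (0 : ℂ) s := by rw [mem_ball_zero_iff]; linarith
  have hall : ∀ n : ℕ, ∃ (Z : Fin n → ℂ) (u : ℂ → ℂ), DifferentiableOn ℂ u (ball 0 s) ∧
      (∀ i, ‖Z i‖ ≤ q) ∧ (∀ w ∈ ball (0 : ℂ) s, g w = (∏ i, (w - Z i)) * u w) := by
    intro n
    induction n with
    | zero => exact ⟨Fin.elim0, g, hg, fun i => i.elim0, by simp⟩
    | succ n ih =>
      obtain ⟨Z, u, hu, hZ, hfac⟩ := ih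
      obtain ⟨c, hc, huc⟩ := hcon n Z u hu hZ hfac
      have hcs : c ∈ ball (0 : ℂ) s := by rw [mem_ball_zero_iff]; linarith
      refine ⟨Fin.cons c Z, dslope u c,
        (Complex.differentiableOn_dslope (isOpen_ball.mem_nhds hcs)).2 hu, ?_, ?_⟩
      · intro i
        refine Fin.cases ?_ (fun j => ?_) i <;> simp [hc, hZ]
      · intro w hw
        rw [hfac w hw, Fin.prod_univ_succ]
        have := sub_smul_dslope u c w
        rw [huc, sub_zero, smul_eq_mul] at this
        simp only [Fin.cons_zero, Fin.cons_succ]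
        rw [← this]; ring
  have hpos : 0 < ‖g a‖ := norm_pos_iff.2 hga
  have hlim : Filter.Tendsto (fun n : ℕ => S * ((‖a‖ + q) / (s - q)) ^ n) Filter.atTop
      (nhds (S * 0)) := by
    apply Filter.Tendsto.const_mul
    apply tendsto_pow_atTop_nhds_zero_of_lt_one
    · have := norm_nonneg a
      apply div_nonneg <;> linarith
    · rw [div_lt_one (by linarith)]; exact ha
  rw [mul_zero] at hlim
  obtain ⟨n, hn⟩ := (hlim.eventually (gt_mem_nhds hpos)).exists
  obtain ⟨Z, u, hu, hZ, hfac⟩ := hall n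
  exact absurd (norm_le_geometric hqs hu hb hZ hfac has) (not_le.2 hn)

/-- A Harnack inequality for a bounded zero-free function. -/
theorem norm_ge_of_ne_zero {c : ℂ} {t U L : ℝ} {u : ℂ → ℂ} (ht : 0 < t) (hU : 0 < U) (hL : 0 < L)
    (hu : DifferentiableOn ℂ u (ball c (7 * t))) (hne : ∀ w ∈ ball c (7 * t), u w ≠ 0)
    (hb : ∀ w ∈ ball c (7 * t), ‖u w‖ ≤ U) (hc : U * Real.exp (-L) ≤ ‖u c‖)
    {z : ℂ} (hz : ‖z - c‖ ≤ 5 * t) : U * Real.exp (-(6 * L)) ≤ ‖u z‖ := by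
  have hcm : c ∈ ball c (7 * t) := mem_ball_self (by positivity)
  have hzm : z ∈ ball c (7 * t) := by rw [mem_ball, dist_eq_norm]; linarith
  have hderiv : DifferentiableOn ℂ (fun w => deriv u w / u w) (ball c (7 * t)) :=
    (hu.deriv isOpen_ball).div hu hne
  -- Up to a constant, `v` is a branch of `log u`; the lower bound for `u c` bounds the real part of
  -- `v - v c` above by `L`.
  obtain ⟨v, hv⟩ := hderiv.isExactOn_ball
  have hud : ∀ w ∈ ball c (7 * t), HasDerivAt u (deriv u w) w := fun w hw =>
    (hu.differentiableAt (isOpen_ball.mem_nhds hw)).hasDerivAt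
  have hconst : ∀ w ∈ ball c (7 * t), u w * Complex.exp (-(v w - v c)) = u c := by
    intro w hw
    have hd : ∀ x ∈ ball c (7 * t),
        HasDerivAt (fun x => u x * Complex.exp (-(v x - v c))) 0 x := by
      intro x hx
      have h1 : HasDerivAt (fun x => Complex.exp (-(v x - v c)))
          (Complex.exp (-(v x - v c)) * -(deriv u x / u x)) x :=
        (((hv x hx).sub_const (v c)).neg).cexp
      have h2 := (hud x hx).mul h1
      have h3 : deriv u x * Complex.exp (-(v x - v c)) +
          u x * (Complex.exp (-(v x - v c)) * -(deriv u x / u x)) = 0 := by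
        linear_combination (-Complex.exp (-(v x - v c))) * mul_div_cancel₀ (deriv u x) (hne x hx)
      rw [h3] at h2
      exact h2
    have := (convex_ball c (7 * t)).is_const_of_fderivWithin_eq_zero (𝕜 := ℂ)
      (f := fun x => u x * Complex.exp (-(v x - v c)))
      (fun x hx => (hd x hx).differentiableAt.differentiableWithinAt)
      (fun x hx => by
        rw [fderivWithin_of_isOpen isOpen_ball hx]
        exact (hd x hx).hasFDerivAt.fderiv.trans (by ext; simp)) hw hcm
    simpa using this
  have hnorm : ∀ w ∈ ball c (7 * t), ‖u w‖ = ‖u c‖ * Real.exp ((v w - v c).re) := by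
    intro w hw
    rw [← hconst w hw, norm_mul, Complex.norm_exp, mul_assoc, ← Real.exp_add]
    simp
  have huc : 0 < ‖u c‖ := norm_pos_iff.2 (hne c hcm)
  have hre : ∀ w ∈ ball c (7 * t), (v w - v c).re ≤ L := by
    intro w hw
    have h1 := hb w hw
    rw [hnorm w hw] at h1
    have h2 : U * Real.exp (-L) * Real.exp ((v w - v c).re) ≤ U * 1 := by
      rw [mul_one]
      exact le_trans (by gcongr) h1
    rw [mul_assoc, ← Real.exp_add] at h2
    have h3 := le_of_mul_le_mul_left h2 hU
    rw [Real.exp_le_one_iff] at h3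
    linarith
  have hmem : ∀ x ∈ ball (0 : ℂ) (7 * t), c + x ∈ ball c (7 * t) := by
    intro x hx
    simpa using hx
  have hBC := Complex.borelCaratheodory_zero (M := L) (R := 7 * t)
    (f := fun x => v (c + x) - v c) (z := z - c) hL ?_ ?_ (by positivity)
    (by rw [mem_ball_zero_iff]; linarith) (by simp)
  -- Borel–Carathéodory gives the factor `2 * 5t / (7t - 5t) = 5`; the deficit `L` at the centre
  -- makes it `6`.
  · have h5 : ‖v z - v c‖ ≤ 5 * L := by
      have h6 : c + (z - c) = z := by ring
      simp only [h6] at hBC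
      refine hBC.trans ?_
      rw [div_le_iff₀ (by linarith)]
      nlinarith [norm_nonneg (z - c)]
    have h7 : -(5 * L) ≤ (v z - v c).re := by
      have := Complex.abs_re_le_norm (v z - v c)
      have := abs_le.1 this
      linarith [this.1]
    rw [hnorm z hzm]
    calc U * Real.exp (-(6 * L)) = U * Real.exp (-L) * Real.exp (-(5 * L)) := by
          rw [mul_assoc, ← Real.exp_add]; ring_nf
      _ ≤ _ := by gcongr
  · intro x hx
    have := (hv (c + x) (hmem x hx))
    exact ((this.comp_const_add c x).sub_const (v c)).differentiableAt.differentiableWithinAt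
  · intro x hx
    exact hre _ (hmem x hx)

/-- A Cartan type estimate: a lower bound off the zeros, whose number is controlled. -/
theorem exists_zeros_norm_ge {s t S L : ℝ} {g : ℂ → ℂ} {a : ℂ} (ht : 0 < t) (hts : 17 * t < s)
    (hS : 0 < S) (hL : 0 < L) (hg : DifferentiableOn ℂ g (ball 0 s))
    (hb : ∀ w ∈ ball (0 : ℂ) s, ‖g w‖ ≤ S) (ha : ‖a‖ ≤ t) (hga : S * Real.exp (-L) ≤ ‖g a‖) :
    ∃ (n : ℕ) (Z : Fin n → ℂ), n * Real.log ((s - 8 * t) / (9 * t)) ≤ L ∧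
      ∀ z, ‖z‖ ≤ 4 * t → S * Real.exp (-(6 * L)) * ∏ i, (‖z - Z i‖ / s) ≤ ‖g z‖ := by
  have hga0 : g a ≠ 0 := by
    rw [← norm_pos_iff]; exact lt_of_lt_of_le (by positivity) hga
  have has : a ∈ ball (0 : ℂ) s := by rw [mem_ball_zero_iff]; linarith
  -- The radius `8t` leaves a zero-free disc of radius `7t` for `u` about `a`, and `‖z‖ ≤ 4t` lies
  -- within `5t` of `a`. The hypothesis `17 * t < s` is what makes the geometric ratio less than
  -- `1`.
  obtain ⟨n, Z, u, hu, hZ, hfac, hne⟩ := exists_zero_factorization (q := 8 * t) (by linarith) hg hb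
    (by linarith) (by linarith) hga0
  refine ⟨n, Z, ?_, fun z hz => ?_⟩
  · have h1 := norm_le_geometric (by linarith) hu hb hZ hfac has
    have h2 : S * Real.exp (-L) ≤ S * ((9 * t) / (s - 8 * t)) ^ n := by
      refine hga.trans (h1.trans ?_)
      have : 0 < s - 8 * t := by linarith
      gcongr
      linarith
    have h3 := le_of_mul_le_mul_left h2 hS
    have hlam : 0 < (s - 8 * t) / (9 * t) := div_pos (by linarith) (by linarith)
    have h4 : (9 * t) / (s - 8 * t) = ((s - 8 * t) / (9 * t))⁻¹ := by rw [inv_div]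
    rw [h4, inv_pow, ← Real.exp_log (pow_pos hlam n), ← Real.exp_neg, Real.exp_le_exp,
      Real.log_pow] at h3
    linarith
  · have hsn : 0 < (s - 8 * t) ^ n := pow_pos (by linarith) n
    have hs : 0 < s := by linarith
    have hsub : ball a (7 * t) ⊆ ball 0 (8 * t) := by
      intro w hw
      rw [mem_ball, dist_eq_norm] at hw
      rw [mem_ball_zero_iff]
      have := norm_sub_norm_le w a
      linarith
    have hsub' : ball a (7 * t) ⊆ ball 0 s := hsub.trans (ball_subset_ball (by linarith))
    -- The upper bound for `u` and the lower bound at `a` carry the same factor `(s - 8t) ^ n`, so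
    -- the Harnack loss does not depend on `n`.
    have hua : S / (s - 8 * t) ^ n * Real.exp (-L) ≤ ‖u a‖ := by
      have h1 : ‖g a‖ ≤ (s - 8 * t) ^ n * ‖u a‖ := by
        rw [hfac a has, norm_mul, norm_prod]
        gcongr
        calc ∏ i, ‖a - Z i‖ ≤ ∏ _i : Fin n, (s - 8 * t) :=
              Finset.prod_le_prod (fun _ _ => norm_nonneg _) fun i _ =>
                (norm_sub_le _ _).trans (by linarith [hZ i])
          _ = _ := by simp
      rw [div_mul_eq_mul_div, div_le_iff₀ hsn, mul_comm ‖u a‖]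
      exact hga.trans h1
    have hz5 : ‖z - a‖ ≤ 5 * t := (norm_sub_le _ _).trans (by linarith)
    have huz := norm_ge_of_ne_zero ht (div_pos hS hsn) hL (hu.mono hsub')
      (fun w hw => hne w (by have := hsub hw; rw [mem_ball_zero_iff] at this; exact this.le))
      (fun w hw => norm_cofactor_le (by linarith) hu hb hZ hfac (hsub' hw)) hua hz5
    have hzs : z ∈ ball (0 : ℂ) s := by rw [mem_ball_zero_iff]; linarith
    rw [hfac z hzs, norm_mul, norm_prod, mul_comm (∏ i, ‖z - Z i‖)]
    have h1 : ∏ i, (‖z - Z i‖ / s) = (∏ i, ‖z - Z i‖) / s ^ n := by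
      rw [Finset.prod_div_distrib]; simp
    have h2 : S / s ^ n ≤ S / (s - 8 * t) ^ n := by
      gcongr <;> linarith
    have hpz : 0 ≤ ∏ i, ‖z - Z i‖ := Finset.prod_nonneg fun _ _ => norm_nonneg _
    calc S * Real.exp (-(6 * L)) * ∏ i, (‖z - Z i‖ / s)
        = S / s ^ n * Real.exp (-(6 * L)) * ∏ i, ‖z - Z i‖ := by rw [h1]; ring
      _ ≤ S / (s - 8 * t) ^ n * Real.exp (-(6 * L)) * ∏ i, ‖z - Z i‖ := by gcongr
      _ ≤ _ := by gcongr

/-- A function which is not small near the centre is bounded below on some circle. -/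
theorem exists_circle_norm_ge {S L : ℝ} {g : ℂ → ℂ} {a : ℂ}
    (hS : 0 < S) (hL : 0 < L) (hg : DifferentiableOn ℂ g (ball 0 (1 / 4)))
    (hb : ∀ w ∈ ball (0 : ℂ) (1 / 4), ‖g w‖ ≤ S) (ha : ‖a‖ ≤ 1 / 256)
    (hga : S * Real.exp (-L) ≤ ‖g a‖) :
    ∃ r ∈ Icc (1 / 128 : ℝ) (1 / 64), ∀ w : ℂ, ‖w‖ = r → S * Real.exp (-(11 * L)) ≤ ‖g w‖ := by
  obtain ⟨n, Z, hn, hlow⟩ := exists_zeros_norm_ge (t := 1 / 256) (by norm_num) (by norm_num) hS hL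
    hg hb ha hga
  have hnL : (n : ℝ) ≤ L := by
    refine le_trans ?_ hn
    have : 1 ≤ Real.log ((1 / 4 - 8 * (1 / 256)) / (9 * (1 / 256))) := by
      rw [Real.le_log_iff_exp_le (by norm_num)]
      linarith [Real.exp_one_lt_d9]
    nlinarith [n.cast_nonneg (α := ℝ)]
  -- Each zero costs a factor `(1 / 512) / (1 / 4) = 1 / 128 ≥ exp (-5)`, and there are at most `L`
  -- of them; hence `11 = 6 + 5`.
  obtain ⟨r, hr, hprod⟩ := exists_prod_abs_sub_ge (fun i => ‖Z i‖) (3 / 256)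
    (l := 1 / 256) (by norm_num)
  refine ⟨r, ⟨by linarith [hr.1], by linarith [hr.2]⟩, fun w hw => ?_⟩
  refine le_trans ?_ (hlow w (by rw [hw]; linarith [hr.2]))
  have h1 : ((1 : ℝ) / 128) ^ n ≤ ∏ i, (‖w - Z i‖ / (1 / 4)) := by
    have : ((1 : ℝ) / 128) ^ n = (1 / 256 / 2) ^ n * ∏ _i : Fin n, (4 : ℝ) := by
      rw [Finset.prod_const, Finset.card_univ, Fintype.card_fin, ← mul_pow]; norm_num
    rw [this]
    refine (mul_le_mul_of_nonneg_right hprod (by positivity)).trans ?_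
    rw [← Finset.prod_mul_distrib]
    refine Finset.prod_le_prod (fun _ _ => by positivity) fun i _ => ?_
    have := abs_norm_sub_norm_le w (Z i)
    rw [hw] at this
    simp only [one_div, div_inv_eq_mul]
    gcongr
  have h2 : Real.exp (-(5 * L)) ≤ ((1 : ℝ) / 128) ^ n := by
    have h3 : Real.exp (-5) ≤ 1 / 128 := by
      rw [Real.exp_neg, one_div]
      apply inv_anti₀ (by norm_num)
      have h5 : Real.exp 5 = Real.exp 1 ^ 5 := by rw [← Real.exp_nat_mul]; norm_num
      rw [h5]
      calc (128 : ℝ) ≤ 2.7 ^ 5 := by norm_num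
        _ ≤ _ := by gcongr; linarith [Real.exp_one_gt_d9]
    calc Real.exp (-(5 * L)) ≤ Real.exp (n * (-5)) := by
          rw [Real.exp_le_exp]; linarith
      _ = Real.exp (-5) ^ n := Real.exp_nat_mul _ _
      _ ≤ _ := by gcongr
  calc S * Real.exp (-(11 * L)) = S * Real.exp (-(6 * L)) * Real.exp (-(5 * L)) := by
        rw [mul_assoc, ← Real.exp_add]; ring_nf
    _ ≤ _ := by gcongr; exact h2.trans h1

/-! ### Hankel determinants and the resultant. -/

/-- Holomorphic dependence of a circle integral on a parameter. -/
theorem differentiableOn_circleIntegral {U : Set ℂ} (hU : IsOpen U) {r : ℝ} (hr : 0 ≤ r)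
    {Φ : ℂ × ℂ → ℂ} (hΦ : ∀ z ∈ U, ∀ w : ℂ, ‖w‖ = r → AnalyticAt ℂ Φ (z, w)) :
    DifferentiableOn ℂ (fun z => ∮ w in C(0, r), Φ (z, w)) U := by
  intro z₀ hz₀
  apply DifferentiableAt.differentiableWithinAt
  obtain ⟨ε, hε, hεU⟩ := nhds_basis_closedBall.mem_iff.1 (hU.mem_nhds hz₀)
  have hcirc : ∀ θ : ℝ, ‖circleMap 0 r θ‖ = r := fun θ => by
    simp [circleMap, abs_of_nonneg hr]
  have hK : IsCompact (closedBall z₀ ε ×ˢ sphere (0 : ℂ) r) :=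
    (isCompact_closedBall z₀ ε).prod (isCompact_sphere _ _)
  have hcontK : ContinuousOn (fun p => ‖fderiv ℂ Φ p‖) (closedBall z₀ ε ×ˢ sphere (0 : ℂ) r) := by
    rintro ⟨z, w⟩ ⟨hz, hw⟩
    exact (hΦ z (hεU hz) w (by simpa using hw)).fderiv.continuousAt.norm.continuousWithinAt
  obtain ⟨M, hM⟩ := (hK.image_of_continuousOn hcontK).bddAbove
  have hcurve : ∀ z ∈ U, Continuous fun θ : ℝ => Φ (z, circleMap 0 r θ) := by
    intro z hz
    refine continuous_iff_continuousAt.2 fun θ => ?_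
    exact ContinuousAt.comp (g := Φ) (hΦ z hz _ (hcirc θ)).continuousAt
      (by have := (continuous_circleMap 0 r).continuousAt (x := θ); fun_prop)
  have hcurve' : Continuous fun θ : ℝ => fderiv ℂ Φ (z₀, circleMap 0 r θ) (1, 0) := by
    refine continuous_iff_continuousAt.2 fun θ => ?_
    have h1 : ContinuousAt (fun θ : ℝ => fderiv ℂ Φ (z₀, circleMap 0 r θ)) θ :=
      ContinuousAt.comp (g := fderiv ℂ Φ) (hΦ z₀ hz₀ _ (hcirc θ)).fderiv.continuousAt
        (by have := (continuous_circleMap 0 r).continuousAt (x := θ); fun_prop)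
    exact h1.clm_apply continuousAt_const
  have hdm : Continuous (deriv (circleMap 0 r)) := by
    have : deriv (circleMap 0 r) = fun θ => circleMap 0 r θ * Complex.I := by
      ext θ; simp
    rw [this]; fun_prop
  simp only [circleIntegral]
  refine (intervalIntegral.hasDerivAt_integral_of_dominated_loc_of_deriv_le (μ := MeasureTheory.volume)
    (F := fun z θ => deriv (circleMap 0 r) θ • Φ (z, circleMap 0 r θ))
    (F' := fun z θ => deriv (circleMap 0 r) θ • fderiv ℂ Φ (z, circleMap 0 r θ) (1, 0))
    (bound := fun _ => r * (M * 1)) (s := ball z₀ ε)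
    (ball_mem_nhds _ hε) ?_ ?_ ?_ ?_ ?_ ?_).2.differentiableAt
  · filter_upwards [hU.mem_nhds hz₀] with z hz
    exact (hdm.smul (hcurve z hz)).aestronglyMeasurable
  · exact (hdm.smul (hcurve z₀ hz₀)).intervalIntegrable _ _
  · exact (hdm.smul hcurve').aestronglyMeasurable
  · filter_upwards with θ _ z hz
    have hM' : ‖fderiv ℂ Φ (z, circleMap 0 r θ)‖ ≤ M := by
      refine hM ⟨(z, circleMap 0 r θ), ⟨ball_subset_closedBall hz, ?_⟩, rfl⟩
      simp [hcirc]
    rw [norm_smul]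
    gcongr
    · simp [abs_of_nonneg hr]
    · refine (ContinuousLinearMap.le_opNorm _ _).trans ?_
      have h1 : ‖((1 : ℂ), (0 : ℂ))‖ ≤ 1 := by simp [Prod.norm_def]
      gcongr
      exact (norm_nonneg _).trans hM'
  · exact intervalIntegrable_const
  · filter_upwards with θ _ z hz
    have h1 : HasFDerivAt Φ (fderiv ℂ Φ (z, circleMap 0 r θ)) (z, circleMap 0 r θ) :=
      (hΦ z (hεU (ball_subset_closedBall hz)) _ (hcirc θ)).differentiableAt.hasFDerivAt
    have h2 : HasDerivAt (fun z : ℂ => (z, circleMap 0 r θ)) ((1 : ℂ), (0 : ℂ)) z :=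
      (hasDerivAt_id z).prodMk (hasDerivAt_const _ _)
    exact HasDerivAt.const_smul (deriv (circleMap 0 r) θ) (h1.comp_hasDerivAt z h2)

section Hankel

open Polynomial

/-- The Hankel matrix of a functional has the same determinant in any pair of monic bases. -/
theorem det_functional_monic {d : ℕ} (Λ : ℂ[X] →ₗ[ℂ] ℂ) (p q : Fin d → ℂ[X])
    (hp : ∀ i, (p i).natDegree = i) (hpm : ∀ i, (p i).Monic)
    (hq : ∀ i, (q i).natDegree = i) (hqm : ∀ i, (q i).Monic) :
    (Matrix.of fun j k : Fin d => Λ (q j * p k)).det =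
      (Matrix.of fun j k : Fin d => Λ (X ^ ((j : ℕ) + k))).det := by
  -- Expanding in monomials exhibits the matrix as the Hankel matrix between two triangular matrices
  -- with unit diagonal.
  have key : (Matrix.of fun j k : Fin d => Λ (q j * p k)) =
      (Matrix.of fun i j : Fin d => (q j).coeff i).transpose *
        (Matrix.of fun j k : Fin d => Λ (X ^ ((j : ℕ) + k))) *
        (Matrix.of fun i j : Fin d => (p j).coeff i) := by
    ext a b
    have expand : ∀ f : ℂ[X], f.natDegree < d → f = ∑ i : Fin d, f.coeff i • (X : ℂ[X]) ^ (i : ℕ) := by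
      intro f hf
      conv_lhs => rw [Polynomial.as_sum_range' f d hf]
      rw [← Fin.sum_univ_eq_sum_range (fun i => Polynomial.monomial i (f.coeff i))]
      refine Finset.sum_congr rfl fun i _ => ?_
      rw [← Polynomial.C_mul_X_pow_eq_monomial, Polynomial.smul_eq_C_mul]
    have ha := expand (q a) (by rw [hq]; exact a.2)
    have hb := expand (p b) (by rw [hp]; exact b.2)
    simp only [Matrix.of_apply, Matrix.mul_apply, Matrix.transpose_apply]
    conv_lhs => rw [ha, hb]
    rw [Finset.sum_mul_sum, Finset.sum_comm, map_sum]
    refine Finset.sum_congr rfl fun k _ => ?_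
    rw [map_sum, Finset.sum_mul]
    refine Finset.sum_congr rfl fun j _ => ?_
    rw [smul_mul_smul_comm, map_smul, ← pow_add, smul_eq_mul]
    ring
  rw [key, Matrix.det_mul, Matrix.det_mul, Matrix.det_transpose,
    Matrix.det_matrixOfPolynomials q hq hqm, Matrix.det_matrixOfPolynomials p hp hpm]
  ring

/-- The Hankel determinant of a functional on `ℂ[X] / ∏ (X - Z i)`. -/
theorem norm_det_hankel_functional {d : ℕ} (Λ : ℂ[X] →ₗ[ℂ] ℂ) (Z : Fin d → ℂ)
    (hΛ : ∀ f : ℂ[X], (∏ i, (X - C (Z i))) ∣ f → Λ f = 0) :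
    ‖(Matrix.of fun j k : Fin d => Λ (X ^ ((j : ℕ) + k))).det‖ =
      ∏ j, ‖Λ (∏ i ∈ Finset.univ.erase j, (X - C (Z i)))‖ := by
  -- With the rows reversed, the entry `(j, k)` is `Λ` of the product over `i > j` times the product
  -- over `i < k`. For `j < k` the full product divides it, so the matrix is triangular, and its
  -- diagonal omits exactly the factor `j`. Repeated zeros need no separate treatment.
  set p : Fin d → ℂ[X] := fun k => ∏ i ∈ Finset.Iio k, (X - C (Z i)) with hp
  set q : Fin d → ℂ[X] := fun j => ∏ i ∈ Finset.Ioi j.rev, (X - C (Z i)) with hq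
  have hmon : ∀ s : Finset (Fin d), (∏ i ∈ s, (X - C (Z i))).Monic := fun s =>
    monic_prod_of_monic _ _ fun i _ => monic_X_sub_C _
  have hdeg : ∀ s : Finset (Fin d), (∏ i ∈ s, (X - C (Z i))).natDegree = s.card := fun s => by
    rw [natDegree_prod_of_monic _ _ fun i _ => monic_X_sub_C _]; simp
  rw [← det_functional_monic Λ p q (fun i => by simp [hp, hdeg]) (fun i => hmon _)
    (fun i => by simp only [hq, hdeg, Fin.card_Ioi, Fin.val_rev]; omega) (fun i => hmon _)]
  set T : Matrix (Fin d) (Fin d) ℂ := Matrix.of fun j k => Λ (q j * p k) with hT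
  have h1 : ‖T.det‖ = ‖(T.submatrix Fin.revPerm id).det‖ := by
    rw [Matrix.det_permute, norm_mul]
    rcases Int.units_eq_one_or (Equiv.Perm.sign (Fin.revPerm : Equiv.Perm (Fin d))) with h | h <;>
      simp [h]
  have htri : (T.submatrix Fin.revPerm id).BlockTriangular OrderDual.toDual := by
    intro j k hjk
    have hjk' : j < k := hjk
    simp only [Matrix.submatrix_apply, hT, Matrix.of_apply, id, Fin.revPerm_apply, hq, hp,
      Fin.rev_rev]
    apply hΛ
    have h2 : (Finset.univ : Finset (Fin d)) = Finset.Ioi j ∪ Finset.Iic j := by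
      ext i; simp [lt_or_ge]
    rw [h2, Finset.prod_union]
    · exact mul_dvd_mul_left _ (Finset.prod_dvd_prod_of_subset _ _ _ fun i hi => by
        simp only [Finset.mem_Iic, Finset.mem_Iio] at *; omega)
    · rw [Finset.disjoint_left]
      intro i hi hi'
      simp only [Finset.mem_Iic, Finset.mem_Ioi] at *; omega
  rw [h1, Matrix.det_of_isLowerTriangular _ htri, norm_prod]
  refine Finset.prod_congr rfl fun j _ => ?_
  simp only [Matrix.submatrix_apply, hT, Matrix.of_apply, id, Fin.revPerm_apply, hq, hp,
    Fin.rev_rev]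
  rw [← Finset.prod_union]
  · congr 3
    ext i
    simp only [Finset.mem_union, Finset.mem_Ioi, Finset.mem_Iio, Finset.mem_erase, Finset.mem_univ,
      and_true]
    omega
  · rw [Finset.disjoint_left]
    intro i hi hi'
    simp only [Finset.mem_Iio, Finset.mem_Ioi] at *; omega

/-- The Hankel determinant of the moments of `h / g` is, up to sign, the product of `h / u` over
the zeros of `g = ∏ (w - Z i) * u`. -/
theorem norm_det_hankel {ρ r : ℝ} (hr : 0 < r) (hrρ : r < ρ) {d : ℕ} {Z : Fin d → ℂ}
    (hZ : ∀ i, ‖Z i‖ < r) {u g h : ℂ → ℂ} (hu : DifferentiableOn ℂ u (ball 0 ρ))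
    (hh : DifferentiableOn ℂ h (ball 0 ρ)) (hne : ∀ w, ‖w‖ ≤ r → u w ≠ 0)
    (hfac : ∀ w ∈ ball (0 : ℂ) ρ, g w = (∏ i, (w - Z i)) * u w) :
    ‖(Matrix.of fun j k : Fin d => (2 * Real.pi * Complex.I : ℂ)⁻¹ *
      ∮ w in C(0, r), w ^ ((j : ℕ) + k) * (h w / g w)).det‖ = ∏ i, ‖h (Z i) / u (Z i)‖ := by
  have hsub : closedBall (0 : ℂ) r ⊆ ball 0 ρ := closedBall_subset_ball hrρ
  have hhu : DifferentiableOn ℂ (fun w => h w / u w) (closedBall 0 r) :=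
    (hh.mono hsub).div (hu.mono hsub) fun w hw => hne w (by simpa using hw)
  have hwZ : ∀ w ∈ sphere (0 : ℂ) r, ∀ i, w - Z i ≠ 0 := by
    intro w hw i hi
    have h1 : ‖w‖ = r := by simpa using hw
    rw [sub_eq_zero.1 hi] at h1
    exact absurd h1 (hZ i).ne
  have hg : ∀ w ∈ sphere (0 : ℂ) r, g w = (∏ i, (w - Z i)) * u w := fun w hw =>
    hfac w (hsub (sphere_subset_closedBall hw))
  have hgne : ∀ w ∈ sphere (0 : ℂ) r, g w ≠ 0 := by
    intro w hw
    rw [hg w hw]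
    exact mul_ne_zero (Finset.prod_ne_zero_iff.2 fun i _ => hwZ w hw i)
      (hne w (by have : ‖w‖ = r := by simpa using hw
                 exact this.le))
  have hgc : ContinuousOn (fun w => h w / g w) (sphere 0 r) := by
    have hss : sphere (0 : ℂ) r ⊆ ball 0 ρ := sphere_subset_closedBall.trans hsub
    have h1 : ContinuousOn g (sphere 0 r) := by
      refine ContinuousOn.congr (f := fun w => (∏ i, (w - Z i)) * u w) ?_ hg
      exact (by fun_prop : Continuous fun w : ℂ => ∏ i, (w - Z i)).continuousOn.mul
        (hu.continuousOn.mono hss)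
    exact (hh.continuousOn.mono hss).div h1 hgne
  have hint : ∀ f : ℂ[X], CircleIntegrable (fun w => f.eval w * (h w / g w)) 0 r := fun f =>
    ContinuousOn.circleIntegrable hr.le (f.continuous.continuousOn.mul hgc)
  -- By Cauchy's theorem this functional kills multiples of `∏ i, (X - C (Z i))`; by Cauchy's
  -- formula it sends the product without factor `j` to `h (Z j) / u (Z j)`.
  let Λ : ℂ[X] →ₗ[ℂ] ℂ :=
    { toFun := fun f => (2 * Real.pi * Complex.I : ℂ)⁻¹ * ∮ w in C(0, r), f.eval w * (h w / g w)
      map_add' := fun f₁ f₂ => by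
        rw [← mul_add, ← circleIntegral.integral_add (hint f₁) (hint f₂)]
        simp only [eval_add, add_mul]
      map_smul' := fun c f => by
        simp only [eval_smul, smul_eq_mul, mul_assoc, circleIntegral.integral_const_mul,
          RingHom.id_apply]
        ring }
  have hΛ : ∀ f, Λ f = (2 * Real.pi * Complex.I : ℂ)⁻¹ *
    ∮ w in C(0, r), f.eval w * (h w / g w) := fun f => rfl
  have hmain := norm_det_hankel_functional Λ Z ?_
  · simp only [hΛ, eval_pow, eval_X] at hmain
    rw [hmain]
    refine Finset.prod_congr rfl fun j _ => ?_
    congr 1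
    have h1 : ∮ w in C(0, r),
        eval w (∏ i ∈ Finset.univ.erase j, (X - C (Z i))) * (h w / g w) =
        ∮ w in C(0, r), (w - Z j)⁻¹ • (h w / u w) := by
      refine circleIntegral.integral_congr hr.le fun w hw => ?_
      have h2 := Finset.mul_prod_erase Finset.univ (fun i => w - Z i) (Finset.mem_univ j)
      simp only [eval_prod, eval_sub, eval_X, eval_C, smul_eq_mul]
      rw [hg w hw, ← h2]
      have h3 : ∏ i ∈ Finset.univ.erase j, (w - Z i) ≠ 0 :=
        Finset.prod_ne_zero_iff.2 fun i _ => hwZ w hw i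
      have h4 := hwZ w hw j
      field_simp
    rw [h1, hhu.circleIntegral_sub_inv_smul (by simpa using hZ j), smul_eq_mul, ← mul_assoc,
      inv_mul_cancel₀ Complex.two_pi_I_ne_zero, one_mul]
  · rintro f ⟨f', rfl⟩
    rw [hΛ]
    have h1 : ∮ w in C(0, r), eval w ((∏ i, (X - C (Z i))) * f') * (h w / g w) =
        ∮ w in C(0, r), f'.eval w * (h w / u w) := by
      refine circleIntegral.integral_congr hr.le fun w hw => ?_
      simp only [eval_mul, eval_prod, eval_sub, eval_X, eval_C]
      rw [hg w hw]
      have h3 : ∏ i, (w - Z i) ≠ 0 := Finset.prod_ne_zero_iff.2 fun i _ => hwZ w hw i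
      field_simp
    have h2 : DifferentiableOn ℂ (fun w => f'.eval w * (h w / u w)) (closedBall 0 r) :=
      f'.differentiable.differentiableOn.mul hhu
    rw [h1, DiffContOnCl.circleIntegral_eq_zero hr.le
      (h2.mono closure_ball_subset_closedBall).diffContOnCl, mul_zero]

end Hankel

/-- The logarithmic derivative counts zeros. -/
theorem circleIntegral_logDeriv {ρ r : ℝ} (hr : 0 < r) (hrρ : r < ρ) {d : ℕ} {Z : Fin d → ℂ}
    (hZ : ∀ i, ‖Z i‖ < r) {u g : ℂ → ℂ} (hu : DifferentiableOn ℂ u (ball 0 ρ))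
    (hne : ∀ w, ‖w‖ ≤ r → u w ≠ 0)
    (hfac : ∀ w ∈ ball (0 : ℂ) ρ, g w = (∏ i, (w - Z i)) * u w) :
    ∮ w in C(0, r), deriv g w / g w = 2 * Real.pi * Complex.I * d := by
  have hsub : closedBall (0 : ℂ) r ⊆ ball 0 ρ := closedBall_subset_ball hrρ
  have hwZ : ∀ w ∈ sphere (0 : ℂ) r, ∀ i, w - Z i ≠ 0 := by
    intro w hw i hi
    have h1 : ‖w‖ = r := by simpa using hw
    rw [sub_eq_zero.1 hi] at h1
    exact absurd h1 (hZ i).ne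
  have hlu : DifferentiableOn ℂ (fun w => deriv u w / u w) (closedBall 0 r) :=
    ((hu.deriv isOpen_ball).mono hsub).div (hu.mono hsub) fun w hw => hne w (by simpa using hw)
  have h1 : ∮ w in C(0, r), deriv g w / g w =
      ∮ w in C(0, r), ((∑ i, (w - Z i)⁻¹) + deriv u w / u w) := by
    refine circleIntegral.integral_congr hr.le fun w hw => ?_
    have hwρ : w ∈ ball (0 : ℂ) ρ := hsub (sphere_subset_closedBall hw)
    have hwr : ‖w‖ = r := by simpa using hw
    have h2 : logDeriv g w = logDeriv (fun w => (∏ i, (w - Z i)) * u w) w :=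
      (logDeriv_congr_nhds
        (Filter.eventually_of_mem (isOpen_ball.mem_nhds hwρ) hfac)).self_of_nhds
    change logDeriv g w = _
    rw [h2, logDeriv_mul (f := fun w => ∏ i, (w - Z i)) w
      (Finset.prod_ne_zero_iff.2 fun i _ => hwZ w hw i) (hne w hwr.le) (by fun_prop)
      (hu.differentiableAt (isOpen_ball.mem_nhds hwρ))]
    congr 1
    have h3 := logDeriv_prod (s := Finset.univ) (f := fun i w => w - Z i) (x := w)
      (fun i _ => hwZ w hw i) (fun i _ => by fun_prop)
    rw [h3]
    refine Finset.sum_congr rfl fun i _ => ?_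
    simp [logDeriv_apply]
  have hi : ∀ i, CircleIntegrable (fun w => (w - Z i)⁻¹) 0 r := fun i =>
    ContinuousOn.circleIntegrable hr.le
      ((continuousOn_id.sub continuousOn_const).inv₀ fun w hw => hwZ w hw i)
  rw [h1, circleIntegral.integral_add, circleIntegral.integral_fun_sum fun i _ => hi i,
    DiffContOnCl.circleIntegral_eq_zero hr.le
      (hlu.mono closure_ball_subset_closedBall).diffContOnCl]
  · have : ∀ i, ∮ w in C(0, r), (w - Z i)⁻¹ = 2 * Real.pi * Complex.I := fun i =>
      circleIntegral.integral_sub_inv_of_mem_ball (by simpa using hZ i)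
    simp [this, mul_comm]
  · exact CircleIntegrable.fun_sum _ fun i _ => hi i
  · exact ContinuousOn.circleIntegrable hr.le (hlu.continuousOn.mono sphere_subset_closedBall)

/-- The resultant, in the second variable, of two functions of two variables: a holomorphic
function of the first variable with modulus the product of `G₂ / u` over the zeros of `G₁`. -/
theorem exists_resultant {s ρ r S : ℝ} {G₁ G₂ : ℂ × ℂ → ℂ} (hs : 0 < s) (hr : 0 < r)
    (hrρ : 3 * r < ρ)
    (h₁ : ∀ z w : ℂ, ‖z‖ < s → ‖w‖ < ρ → AnalyticAt ℂ G₁ (z, w))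
    (h₂ : ∀ z w : ℂ, ‖z‖ < s → ‖w‖ < ρ → AnalyticAt ℂ G₂ (z, w))
    (hb : ∀ z w : ℂ, ‖z‖ < s → ‖w‖ < ρ → ‖G₁ (z, w)‖ ≤ S)
    (hne : ∀ z w : ℂ, ‖z‖ < s → ‖w‖ = r → G₁ (z, w) ≠ 0) :
    ∃ (d : ℕ) (R : ℂ → ℂ), DifferentiableOn ℂ R (ball 0 s) ∧ ∀ z : ℂ, ‖z‖ < s →
      ∃ (Z : Fin d → ℂ) (u : ℂ → ℂ), DifferentiableOn ℂ u (ball 0 ρ) ∧ (∀ i, ‖Z i‖ < r) ∧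
        (∀ w ∈ ball (0 : ℂ) ρ, G₁ (z, w) = (∏ i, (w - Z i)) * u w) ∧
        (∀ w, ‖w‖ ≤ r → u w ≠ 0) ∧ ‖R z‖ = ∏ i, ‖G₂ (z, Z i) / u (Z i)‖ := by
  have hsl : ∀ G : ℂ × ℂ → ℂ, (∀ z w : ℂ, ‖z‖ < s → ‖w‖ < ρ → AnalyticAt ℂ G (z, w)) →
      ∀ z : ℂ, ‖z‖ < s → DifferentiableOn ℂ (fun w => G (z, w)) (ball 0 ρ) := by
    intro G hG z hz w hw
    have h1 := (hG z w hz (by simpa using hw)).differentiableAt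
    exact (DifferentiableAt.comp (f := fun w : ℂ => (z, w)) w h1
      (by fun_prop)).differentiableWithinAt
  have hrn : ‖(r : ℂ)‖ = r := by simp [abs_of_pos hr]
  have hfac : ∀ z : ℂ, ‖z‖ < s → ∃ (d : ℕ) (Z : Fin d → ℂ) (u : ℂ → ℂ),
      DifferentiableOn ℂ u (ball 0 ρ) ∧ (∀ i, ‖Z i‖ < r) ∧
        (∀ w ∈ ball (0 : ℂ) ρ, G₁ (z, w) = (∏ i, (w - Z i)) * u w) ∧
        (∀ w, ‖w‖ ≤ r → u w ≠ 0) := by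
    intro z hz
    obtain ⟨d, Z, u, hu, hZ, hf, hun⟩ := exists_zero_factorization (q := r) (a := (r : ℂ)) (S := S)
      (by linarith) (hsl G₁ h₁ z hz) (fun w hw => hb z w hz (by simpa using hw))
      (by rw [hrn]; linarith) hr.le (hne z r hz hrn)
    refine ⟨d, Z, u, hu, fun i => lt_of_le_of_ne (hZ i) fun h => ?_, hf, hun⟩
    apply hne z (Z i) hz h
    rw [hf (Z i) (by rw [mem_ball_zero_iff]; linarith), Finset.prod_eq_zero (Finset.mem_univ i)
      (sub_self _), zero_mul]
  -- The number of zeros inside the circle is continuous in `z` and integer-valued, hence constant.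
  -- This keeps the size of the Hankel matrix fixed.
  set N : ℂ → ℂ := fun z => ∮ w in C(0, r), fderiv ℂ G₁ (z, w) (0, 1) / G₁ (z, w) with hN
  have hND : DifferentiableOn ℂ N (ball 0 s) := by
    refine differentiableOn_circleIntegral isOpen_ball hr.le
      (Φ := fun p => fderiv ℂ G₁ p (0, 1) / G₁ p) fun z hz w hw => ?_
    have hz' : ‖z‖ < s := by simpa using hz
    have ha := h₁ z w hz' (by linarith)
    exact AnalyticAt.div ((ContinuousLinearMap.apply ℂ ℂ ((0 : ℂ), (1 : ℂ))).analyticAt _ |>.comp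
      ha.fderiv) ha (hne z w hz' hw)
  have hNd : ∀ z : ℂ, ‖z‖ < s → ∀ (d : ℕ) (Z : Fin d → ℂ) (u : ℂ → ℂ),
      DifferentiableOn ℂ u (ball 0 ρ) → (∀ i, ‖Z i‖ < r) →
        (∀ w ∈ ball (0 : ℂ) ρ, G₁ (z, w) = (∏ i, (w - Z i)) * u w) →
        (∀ w, ‖w‖ ≤ r → u w ≠ 0) → N z = 2 * Real.pi * Complex.I * d := by
    intro z hz d Z u hu hZ hf hun
    rw [← circleIntegral_logDeriv hr (by linarith) hZ hu hun hf]
    refine circleIntegral.integral_congr hr.le fun w hw => ?_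
    have hw' : ‖w‖ = r := by simpa using hw
    have h3 := (h₁ z w hz (by linarith)).differentiableAt.hasFDerivAt
    have h4 : HasDerivAt (fun w : ℂ => (z, w)) ((0 : ℂ), (1 : ℂ)) w :=
      (hasDerivAt_const _ _).prodMk (hasDerivAt_id w)
    have h5 := (h3.comp_hasDerivAt w h4).deriv
    change _ = deriv (fun w => G₁ (z, w)) w / G₁ (z, w)
    rw [← h5]
    rfl
  obtain ⟨d, Z₀, u₀, hu₀, hZ₀, hf₀, hun₀⟩ := hfac 0 (by simpa using hs)
  have hN0 := hNd 0 (by simpa using hs) d Z₀ u₀ hu₀ hZ₀ hf₀ hun₀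
  have hcount : ∀ z : ℂ, ‖z‖ < s → ∀ d' : ℕ, N z = 2 * Real.pi * Complex.I * d' → d' = d := by
    intro z hz d' hd'
    set φ : ℂ → ℝ := fun z => ((2 * Real.pi * Complex.I : ℂ)⁻¹ * N z).re with hφ
    have hφc : ContinuousOn φ (ball 0 s) :=
      Complex.continuous_re.comp_continuousOn (continuousOn_const.mul hND.continuousOn)
    have hφv : ∀ z n, N z = 2 * Real.pi * Complex.I * (n : ℕ) → φ z = n := by
      intro z n h
      rw [hφ]
      simp only
      rw [h, ← mul_assoc, inv_mul_cancel₀ Complex.two_pi_I_ne_zero, one_mul, Complex.natCast_re]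
    have hint : ∀ z, ‖z‖ < s → ∃ n : ℕ, φ z = n := by
      intro z hz
      obtain ⟨n, Z, u, hu, hZ, hf, hun⟩ := hfac z hz
      exact ⟨n, hφv z n (hNd z hz n Z u hu hZ hf hun)⟩
    have hpre := (convex_ball (0 : ℂ) s).isPreconnected
    have hz' : z ∈ ball (0 : ℂ) s := by simpa using hz
    have h0' : (0 : ℂ) ∈ ball (0 : ℂ) s := mem_ball_self hs
    have hval : ∀ a b : ℂ, a ∈ ball (0 : ℂ) s → b ∈ ball (0 : ℂ) s → ∀ na nb : ℕ, φ a = na →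
        φ b = nb → ¬ na < nb := by
      intro a b ha hb na nb hna hnb hlt
      have hlt' : (na : ℝ) + 1 ≤ nb := by exact_mod_cast hlt
      obtain ⟨c, hc, hcv⟩ := hpre.intermediate_value ha hb hφc
        (show (na : ℝ) + 1 / 2 ∈ Icc (φ a) (φ b) by
          rw [hna, hnb]; constructor <;> linarith)
      obtain ⟨n, hn⟩ := hint c (by simpa using hc)
      rw [hn] at hcv
      have h6 : (2 * n : ℝ) = 2 * na + 1 := by linarith
      have h7 : 2 * n = 2 * na + 1 := by exact_mod_cast h6
      omega
    have := hval z 0 hz' h0' d' d (hφv z d' hd') (hφv 0 d hN0)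
    have := hval 0 z h0' hz' d d' (hφv 0 d hN0) (hφv z d' hd')
    omega
  -- The entries are circle integrals, holomorphic in `z`, although the individual zeros need not
  -- depend holomorphically on `z`.
  refine ⟨d, fun z => (Matrix.of fun j k : Fin d => (2 * Real.pi * Complex.I : ℂ)⁻¹ *
      ∮ w in C(0, r), w ^ ((j : ℕ) + k) * (G₂ (z, w) / G₁ (z, w))).det, ?_, fun z hz => ?_⟩
  · simp only [Matrix.det_apply, Matrix.of_apply]
    refine DifferentiableOn.fun_sum fun σ _ => DifferentiableOn.fun_const_smul
      (DifferentiableOn.fun_finsetProd fun i _ => DifferentiableOn.const_mul ?_ _) _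
    refine differentiableOn_circleIntegral isOpen_ball hr.le
      (Φ := fun p => p.2 ^ ((σ i : ℕ) + i) * (G₂ p / G₁ p)) fun z hz w hw => ?_
    have hz' : ‖z‖ < s := by simpa using hz
    have hwρ : ‖w‖ < ρ := by linarith
    exact (analyticAt_snd.pow _).mul ((h₂ z w hz' hwρ).div (h₁ z w hz' hwρ) (hne z w hz' hw))
  · obtain ⟨n, Z, u, hu, hZ, hf, hun⟩ := hfac z hz
    obtain rfl := hcount z hz n (hNd z hz n Z u hu hZ hf hun)
    exact ⟨Z, u, hu, hZ, hf, hun, norm_det_hankel hr (by linarith) hZ hu (hsl G₂ h₂ z hz) hun hf⟩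

/-! ### From the resultant to a projection with few values. -/

/-- The minimum principle for the zero-free cofactor on a disc of radius at most `1 / 2`. -/
theorem le_norm_cofactor {ρ r m : ℝ} (hr : 0 < r) (hr2 : 2 * r ≤ 1) (hrρ : r < ρ) (hm : 0 < m)
    {d : ℕ} {Z : Fin d → ℂ} (hZ : ∀ i, ‖Z i‖ < r) {u g : ℂ → ℂ}
    (hu : DifferentiableOn ℂ u (ball 0 ρ)) (hne : ∀ w, ‖w‖ ≤ r → u w ≠ 0)
    (hfac : ∀ w ∈ ball (0 : ℂ) ρ, g w = (∏ i, (w - Z i)) * u w)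
    (hg : ∀ w : ℂ, ‖w‖ = r → m ≤ ‖g w‖) {w : ℂ} (hw : ‖w‖ ≤ r) : m ≤ ‖u w‖ := by
  have hsub : closedBall (0 : ℂ) r ⊆ ball 0 ρ := closedBall_subset_ball hrρ
  have hd : DifferentiableOn ℂ (fun w => (u w)⁻¹) (closedBall 0 r) :=
    (hu.mono hsub).inv fun w hw => hne w (by simpa using hw)
  have h1 : ‖(u w)⁻¹‖ ≤ m⁻¹ := by
    refine Complex.norm_le_of_forall_mem_frontier_norm_le (U := ball 0 r) (f := fun w => (u w)⁻¹)
      isBounded_ball (hd.mono closure_ball_subset_closedBall).diffContOnCl ?_ ?_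
    · intro v hv
      rw [frontier_ball _ hr.ne'] at hv
      have hvr : ‖v‖ = r := by simpa using hv
      rw [norm_inv]
      apply inv_anti₀ hm
      have h2 := hg v hvr
      rw [hfac v (hsub (sphere_subset_closedBall hv)), norm_mul, norm_prod] at h2
      have h3 : ∏ i, ‖v - Z i‖ ≤ 1 := Finset.prod_le_one (fun _ _ => norm_nonneg _) fun i _ =>
        (norm_sub_le _ _).trans (by linarith [hZ i])
      exact h2.trans (mul_le_of_le_one_left (norm_nonneg _) h3)
    · rw [closure_ball _ hr.ne']; simpa using hw
  rw [norm_inv] at h1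
  exact (inv_le_inv₀ (norm_pos_iff.2 (hne w hw)) hm).1 h1

/-- Where two functions are both very small, the first coordinate is close to one of a controlled
number of points. -/
theorem exists_finite_projection {s r t S m μ h D A : ℝ} {G₁ G₂ : ℂ × ℂ → ℂ} {z₀ : ℂ}
    (hs : s ≤ 1) (ht : 0 < t) (hts : 17 * t < s) (hr : 0 < r) (hr64 : r ≤ 1 / 64) (hm : 0 < m)
    (hS : S ≤ 1) (hμ : Real.exp (-μ) ≤ m) (hμ0 : 0 ≤ μ) (hh : 0 ≤ h) (hA : 0 < A)
    (hD : S ≤ m * Real.exp D) (hDA : D * (h + μ + 3 * D) ≤ A)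
    (h₁ : ∀ z w : ℂ, ‖z‖ < s → ‖w‖ < 1 / 8 → AnalyticAt ℂ G₁ (z, w))
    (h₂ : ∀ z w : ℂ, ‖z‖ < s → ‖w‖ < 1 / 8 → AnalyticAt ℂ G₂ (z, w))
    (hb₁ : ∀ z w : ℂ, ‖z‖ < s → ‖w‖ < 1 / 8 → ‖G₁ (z, w)‖ ≤ S)
    (hb₂ : ∀ z w : ℂ, ‖z‖ < s → ‖w‖ < 1 / 8 → ‖G₂ (z, w)‖ ≤ 1)
    (hlow : ∀ z w : ℂ, ‖z‖ < s → ‖w‖ = r → m ≤ ‖G₁ (z, w)‖)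
    (hz₀ : ‖z₀‖ ≤ t)
    (htrans : ∀ w : ℂ, ‖w‖ < r → G₁ (z₀, w) = 0 → Real.exp (-h) ≤ ‖G₂ (z₀, w)‖) :
    ∃ (n d : ℕ) (ζ : Fin n → ℂ), (d : ℝ) ≤ D ∧
      n * Real.log ((s - 8 * t) / (9 * t)) ≤ A ∧
      ∀ η ε : ℝ, 0 < η → ε < m * (Real.exp (-(6 * A)) * η ^ n / 64) ^ d →
        ∀ z w : ℂ, ‖z‖ ≤ 4 * t → ‖w‖ < r → ‖G₁ (z, w)‖ < ε → ‖G₂ (z, w)‖ < ε →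
          ∃ i, ‖z - ζ i‖ < η := by
  have hs0 : 0 < s := by linarith
  have hz₀s : ‖z₀‖ < s := by linarith
  have hm1 : m ≤ 1 := by
    have := (hlow z₀ r hz₀s (by simp [abs_of_pos hr])).trans
      (hb₁ z₀ r hz₀s (by simp [abs_of_pos hr]; linarith))
    linarith
  obtain ⟨d, R, hR, hres⟩ := exists_resultant hs0 hr (by linarith : 3 * r < 1 / 8) h₁ h₂ hb₁
    fun z w hz hw h => by
      have := hlow z w hz hw
      rw [h, norm_zero] at this
      linarith
  -- Since `‖u‖ ≥ m` inside the circle, multiplying by `m ^ d` makes every factor at most `1`.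
  have hnorm : ∀ z, ‖z‖ < s → ∀ (Z : Fin d → ℂ) (u : ℂ → ℂ),
      ‖R z‖ = ∏ i, ‖G₂ (z, Z i) / u (Z i)‖ →
      ‖(m : ℂ) ^ d * R z‖ = ∏ i, ‖G₂ (z, Z i)‖ * (m / ‖u (Z i)‖) := by
    intro z hz Z u hRz
    have h3 : ‖(m : ℂ) ^ d‖ = ∏ _i : Fin d, m := by simp [abs_of_pos hm]
    rw [norm_mul, hRz, h3, ← Finset.prod_mul_distrib]
    refine Finset.prod_congr rfl fun i _ => ?_
    rw [norm_div]; ring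
  have hbR : ∀ z ∈ ball (0 : ℂ) s, ‖(m : ℂ) ^ d * R z‖ ≤ 1 := by
    intro z hz
    have hz : ‖z‖ < s := by simpa using hz
    obtain ⟨Z, u, hu, hZ, hf, hun, hRz⟩ := hres z hz
    rw [hnorm z hz Z u hRz]
    refine Finset.prod_le_one (fun _ _ => by positivity) fun i _ => ?_
    have h3 := le_norm_cofactor hr (by linarith) (by linarith) hm hZ hu hun hf
      (fun w hw => hlow z w hz hw) (hZ i).le
    exact mul_le_one₀ (hb₂ z _ hz (by linarith [hZ i])) (by positivity)
      (div_le_one_of_le₀ h3 (norm_nonneg _))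
  -- On the circle each zero contributes a ratio `2r / (1 / 8 - r) ≤ 2 / 7 < exp (-1)`, so `m ≤ S *
  -- exp (-d)`.
  have hdD : (d : ℝ) ≤ D := by
    obtain ⟨Z, u, hu, hZ, hf, hun, hRz⟩ := hres z₀ hz₀s
    have hrn : ‖(r : ℂ)‖ = r := by simp [abs_of_pos hr]
    have h3 := norm_le_geometric (q := r) (S := S) (by linarith) hu
      (fun w hw => hb₁ z₀ w hz₀s (by simpa using hw)) (fun i => (hZ i).le) hf
      (w := (r : ℂ)) (by rw [mem_ball_zero_iff, hrn]; linarith)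
    rw [hrn] at h3
    have hS0 : 0 < S := hm.trans_le ((hlow z₀ r hz₀s hrn).trans
      (hb₁ z₀ r hz₀s (by rw [hrn]; linarith)))
    have h4 : (r + r) / (1 / 8 - r) ≤ Real.exp (-1) := by
      rw [div_le_iff₀ (by linarith), Real.exp_neg]
      have h5 : (1 : ℝ) / 3 ≤ (Real.exp 1)⁻¹ := by
        rw [one_div]
        exact inv_anti₀ (Real.exp_pos 1) (by linarith [Real.exp_one_lt_d9])
      nlinarith
    have h5 : m ≤ S * Real.exp (-d) := by
      refine (hlow z₀ r hz₀s hrn).trans (h3.trans ?_)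
      have h6 : Real.exp (-d) = Real.exp (-1) ^ d := by rw [← Real.exp_nat_mul]; simp
      rw [h6]
      have h7 : 0 ≤ (r + r) / (1 / 8 - r) := div_nonneg (by linarith) (by linarith)
      gcongr
    have h6 : m * 1 ≤ m * Real.exp (D - d) := by
      calc m * 1 ≤ S * Real.exp (-d) := by rw [mul_one]; exact h5
        _ ≤ m * Real.exp D * Real.exp (-d) := by gcongr
        _ = _ := by rw [mul_assoc, ← Real.exp_add, sub_eq_add_neg]
    have h7 := Real.one_le_exp_iff.1 (le_of_mul_le_mul_left h6 hm)
    linarith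
  -- On the fibre `z₀` each factor is at least `exp (-h) * exp (-μ) / exp (3 * d)`, the last term
  -- coming from `‖u‖ ≤ (1 / 8 - r)⁻¹ ^ d`.
  have hlowR : 1 * Real.exp (-A) ≤ ‖(m : ℂ) ^ d * R z₀‖ := by
    obtain ⟨Z, u, hu, hZ, hf, hun, hRz⟩ := hres z₀ hz₀s
    rw [hnorm z₀ hz₀s Z u hRz, one_mul]
    have h3 : ∀ i, Real.exp (-(h + μ + 3 * d)) ≤ ‖G₂ (z₀, Z i)‖ * (m / ‖u (Z i)‖) := by
      intro i
      have hZb : Z i ∈ ball (0 : ℂ) (1 / 8) := by rw [mem_ball_zero_iff]; linarith [hZ i]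
      have hG₁ : G₁ (z₀, Z i) = 0 := by
        rw [hf _ hZb, Finset.prod_eq_zero (Finset.mem_univ i) (sub_self _), zero_mul]
      have hG₂ := htrans (Z i) (hZ i) hG₁
      have hu1 := norm_cofactor_le (q := r) (S := S) (by linarith) hu
        (fun w hw => hb₁ z₀ w hz₀s (by simpa using hw)) (fun i => (hZ i).le) hf hZb
      have hu2 : ‖u (Z i)‖ ≤ Real.exp (3 * d) := by
        refine hu1.trans ?_
        rw [div_le_iff₀ (pow_pos (by linarith) d), mul_comm (3 : ℝ), Real.exp_nat_mul, ← mul_pow]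
        refine hS.trans (one_le_pow₀ ?_)
        have h5 : Real.exp 3 = Real.exp 1 ^ 3 := by rw [← Real.exp_nat_mul]; norm_num
        have h6 : (2.7 : ℝ) ^ 3 ≤ Real.exp 1 ^ 3 := by
          gcongr; linarith [Real.exp_one_gt_d9]
        rw [h5]
        nlinarith
      have hu0 : 0 < ‖u (Z i)‖ := norm_pos_iff.2 (hun _ (hZ i).le)
      calc Real.exp (-(h + μ + 3 * d))
          = Real.exp (-h) * (Real.exp (-μ) / Real.exp (3 * d)) := by
            rw [← Real.exp_sub, ← Real.exp_add]; ring_nf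
        _ ≤ _ := by gcongr
    have hD0 : 0 ≤ D := d.cast_nonneg.trans hdD
    calc Real.exp (-A) ≤ Real.exp (d * (-(h + μ + 3 * d))) := by
          rw [Real.exp_le_exp]
          have : (d : ℝ) * (h + μ + 3 * d) ≤ D * (h + μ + 3 * D) := by gcongr
          linarith
      _ = ∏ _i : Fin d, Real.exp (-(h + μ + 3 * d)) := by rw [Real.exp_nat_mul]; simp
      _ ≤ _ := Finset.prod_le_prod (fun _ _ => (Real.exp_pos _).le) fun i _ => h3 i
  obtain ⟨n, ζ, hn, hcar⟩ := exists_zeros_norm_ge ht hts one_pos hA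
    (hR.const_mul ((m : ℂ) ^ d)) hbR hz₀ hlowR
  refine ⟨n, d, ζ, hdD, hn, fun η ε hη hε z w hz hw hG₁ hG₂ => ?_⟩
  by_contra! hcon
  have hzs : ‖z‖ < s := by linarith
  set X := Real.exp (-(6 * A)) * η ^ n with hX
  have hX0 : 0 < X := by positivity
  have hε0 : 0 < ε := (norm_nonneg _).trans_lt hG₁
  have hXR : X ≤ ‖(m : ℂ) ^ d * R z‖ := by
    refine le_trans ?_ (hcar z hz)
    rw [one_mul, hX]
    gcongr
    calc η ^ n = ∏ _i : Fin n, η := by simp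
      _ ≤ _ := Finset.prod_le_prod (fun _ _ => hη.le) fun i _ => by
        rw [le_div_iff₀ hs0]
        exact (mul_le_of_le_one_right hη.le hs).trans (hcon i)
  have hX1 : X ≤ 1 := hXR.trans (hbR z (by simpa using hzs))
  obtain ⟨Z, u, hu, hZ, hf, hun, hRz⟩ := hres z hzs
  have hum : ∀ w, ‖w‖ ≤ r → m ≤ ‖u w‖ := fun w hw =>
    le_norm_cofactor hr (by linarith) (by linarith) hm hZ hu hun hf
      (fun w hw => hlow z w hzs hw) hw
  have hwb : w ∈ ball (0 : ℂ) (1 / 8) := by rw [mem_ball_zero_iff]; linarith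
  have hprod : (∏ i, ‖w - Z i‖) * m < m * (X / 64) ^ d := by
    refine lt_of_le_of_lt ?_ (hG₁.trans hε)
    rw [hf w hwb, norm_mul, norm_prod]
    gcongr
    exact hum w hw.le
  have hprod' : ∏ i, ‖w - Z i‖ < (X / 64) ^ d := by
    rw [mul_comm] at hprod
    exact lt_of_mul_lt_mul_left hprod hm.le
  -- As `u` is at least `m`, smallness of `G₁ (z, w)` forces `w` close to a zero. For `d = 0` the
  -- empty product already contradicts `hprod'`.
  obtain ⟨i, hi⟩ : ∃ i, ‖w - Z i‖ < X / 64 := by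
    by_contra! hc
    refine absurd hprod' (not_lt.2 ?_)
    calc (X / 64) ^ d = ∏ _i : Fin d, (X / 64) := by
          rw [Finset.prod_const, Finset.card_univ, Fintype.card_fin]
      _ ≤ _ := Finset.prod_le_prod (fun _ _ => by positivity) fun i _ => hc i
  have hd1 : d ≠ 0 := fun hd => by subst hd; exact i.elim0
  have hεX : ε < X / 64 := by
    refine hε.trans_le ?_
    calc m * (X / 64) ^ d ≤ 1 * (X / 64) ^ 1 := by
          gcongr ?_ * ?_
          exact pow_le_pow_of_le_one (by positivity) (by linarith) (Nat.one_le_iff_ne_zero.2 hd1)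
      _ = X / 64 := by ring
  have hlip : ‖G₂ (z, Z i)‖ ≤ ‖G₂ (z, w)‖ + 32 * ‖w - Z i‖ := by
    have hball : ∀ v ∈ ball w (1 / 16), ‖v‖ < 1 / 8 := by
      intro v hv
      rw [mem_ball, dist_eq_norm] at hv
      have := norm_sub_norm_le v w
      linarith
    have hdiff : DifferentiableOn ℂ (fun v => G₂ (z, v)) (ball w (1 / 16)) := by
      intro v hv
      exact (DifferentiableAt.comp (f := fun v : ℂ => (z, v)) v
        (h₂ z v hzs (hball v hv)).differentiableAt (by fun_prop)).differentiableWithinAt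
    have hmaps : MapsTo (fun v => G₂ (z, v)) (ball w (1 / 16))
        (closedBall (G₂ (z, w)) 2) := by
      intro v hv
      rw [mem_closedBall, dist_eq_norm]
      exact (norm_sub_le _ _).trans
        (by linarith [hb₂ z v hzs (hball v hv), hb₂ z w hzs (by linarith)])
    have hZi : Z i ∈ ball w (1 / 16) := by
      rw [mem_ball, dist_eq_norm]
      exact (norm_sub_le _ _).trans_lt (by linarith [hZ i])
    have h3 := Complex.dist_le_div_mul_dist_of_mapsTo_ball hdiff hmaps hZi
    rw [dist_eq_norm, dist_eq_norm, norm_sub_rev (Z i)] at h3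
    have h4 := norm_sub_norm_le (G₂ (z, Z i)) (G₂ (z, w))
    norm_num at h3
    linarith
  have hsmall : ‖(m : ℂ) ^ d * R z‖ ≤ ‖G₂ (z, Z i)‖ := by
    rw [hnorm z hzs Z u hRz, ← Finset.mul_prod_erase _ _ (Finset.mem_univ i)]
    have h3 : ∀ j, m / ‖u (Z j)‖ ≤ 1 := fun j =>
      div_le_one_of_le₀ (hum _ (hZ j).le) (norm_nonneg _)
    have h4 : ∏ j ∈ Finset.univ.erase i, ‖G₂ (z, Z j)‖ * (m / ‖u (Z j)‖) ≤ 1 :=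
      Finset.prod_le_one (fun _ _ => by positivity) fun j _ =>
        mul_le_one₀ (hb₂ z _ hzs (by linarith [hZ j])) (by positivity) (h3 j)
    calc _ ≤ ‖G₂ (z, Z i)‖ * 1 * 1 := by
          gcongr
          exact h3 i
      _ = _ := by ring
  -- `X ≤ ‖G₂ (z, Z i)‖ < X / 64 + 32 * (X / 64) < X`.
  linarith

/-! ### Fibres avoiding the given balls. -/

/-- Among `N + 1` well separated fibres of a Lipschitz map, one misses `N` given balls. -/
theorem exists_fibre_avoiding_balls {N : ℕ} (c : Fin N → C2) {δ : ℝ} (hδ : 0 < δ) {φ : C2 → ℂ}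
    (hφ : ∀ x y, ‖φ x - φ y‖ ≤ 2 * ‖x - y‖) :
    ∃ k : ℕ, k ≤ N ∧ ∀ x, φ x = ((4 * k * δ : ℝ) : ℂ) → ∀ j, x ∉ ball (c j) δ := by
  by_contra! hcon
  -- Two points in one `δ`-ball have `φ`-values less than `4 * δ` apart, whereas the chosen values
  -- differ by at least `4 * δ`.
  choose x hx j hj using fun k : Fin (N + 1) => hcon k (Nat.lt_succ_iff.1 k.2)
  obtain ⟨k, l, hkl, hjj⟩ := Fintype.exists_ne_map_eq_of_card_lt j (by simp)
  have h1 : ‖x k - x l‖ < 2 * δ := by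
    have h2 := hj k
    have h3 := hj l
    rw [← hjj] at h3
    rw [mem_ball] at h2 h3
    rw [← dist_eq_norm]
    linarith [dist_triangle_right (x k) (x l) (c (j k))]
  have h2 := hφ (x k) (x l)
  rw [hx, hx, ← Complex.ofReal_sub, Complex.norm_real, Real.norm_eq_abs] at h2
  have h3 : (1 : ℝ) ≤ |(k : ℝ) - l| := by
    have h4 : (1 : ℤ) ≤ |((k : ℕ) : ℤ) - ((l : ℕ) : ℤ)| := by
      apply Int.one_le_abs
      intro h
      apply hkl
      ext
      omega
    exact_mod_cast h4
  have h4 : (4 * (k : ℕ) * δ - 4 * (l : ℕ) * δ : ℝ) = 4 * δ * ((k : ℕ) - (l : ℕ)) := by ring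
  rw [h4, abs_mul, abs_of_pos (by positivity : 0 < 4 * δ)] at h2
  nlinarith

/-! ### Bernstein exponents and suprema of `log |f|`. -/

theorem log_enorm_of_ne_zero {z : ℂ} (hz : z ≠ 0) :
    ENNReal.log ‖z‖ₑ = ((Real.log ‖z‖ : ℝ) : EReal) := by
  rw [← ofReal_norm, ENNReal.log_ofReal_of_pos (norm_pos_iff.2 hz)]

theorem log_enorm_le_supLog {f : C2 → ℂ} {v x : C2} {R : ℝ} (hx : x ∈ ball v R) :
    ENNReal.log ‖f x‖ₑ ≤ supLog f v R :=
  le_iSup₂ (f := fun x (_ : x ∈ ball v R) => ENNReal.log ‖f x‖ₑ) x hx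

theorem supLog_mono {f : C2 → ℂ} {v v' : C2} {R R' : ℝ} (h : ball v R ⊆ ball v' R') :
    supLog f v R ≤ supLog f v' R' :=
  iSup₂_le fun _ hx => log_enorm_le_supLog (h hx)

theorem norm_le_exp_of_supLog_le {f : C2 → ℂ} {v x : C2} {R M : ℝ} (h : supLog f v R ≤ M)
    (hx : x ∈ ball v R) : ‖f x‖ ≤ Real.exp M := by
  by_cases hf : f x = 0
  · rw [hf, norm_zero]; positivity
  · have h1 := (log_enorm_le_supLog hx).trans h
    rw [log_enorm_of_ne_zero hf, EReal.coe_le_coe_iff] at h1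
    exact (Real.log_le_iff_le_exp (norm_pos_iff.2 hf)).1 h1

/-- A bound for the Bernstein exponent gives doubling of the supremum. -/
theorem supLog_le_supLog_quarter {f : C2 → ℂ} {v p : C2} {R B : ℝ} (hv : v ∈ ball (0 : C2) (1 / 4))
    (hR : R ∈ Ioc (0 : ℝ) (1 / 4)) (hB : bernsteinSup f (1 / 4) ≤ B)
    (hp : p ∈ ball v (R / 4)) (hfp : f p ≠ 0) (htop : supLog f v R ≤ 0) :
    supLog f v R ≤ B + supLog f v (R / 4) := by
  have h1 : bernsteinExp f (1 / 4) v R ≤ B := by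
    refine le_trans ?_ hB
    unfold bernsteinSup
    exact (le_iSup₂ (f := fun R (_ : R ∈ Ioc (0 : ℝ) (1 / 4)) => bernsteinExp f (1 / 4) v R)
      R hR).trans (le_iSup₂ (f := fun v (_ : v ∈ ball (0 : C2) (1 / 4)) =>
        ⨆ R ∈ Ioc (0 : ℝ) (1 / 4), bernsteinExp f (1 / 4) v R) v hv)
  have hsub : ball v (R / 4) ⊆ ball v R := ball_subset_ball (by linarith [hR.1])
  unfold bernsteinExp at h1
  rw [if_neg (fun h => hfp (h p (hsub hp)))] at h1
  have h2 : 1 / 4 * R = R / 4 := by ring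
  rw [h2] at h1
  have hbot : supLog f v (R / 4) ≠ ⊥ := by
    have := log_enorm_le_supLog (f := f) hp
    rw [log_enorm_of_ne_zero hfp] at this
    exact fun h => by rw [h, le_bot_iff] at this; exact EReal.coe_ne_bot _ this
  have htop' : supLog f v (R / 4) ≠ ⊤ := fun h => by
    have := (supLog_mono (f := f) hsub).trans htop
    rw [h, top_le_iff] at this
    exact EReal.zero_ne_top this
  exact (EReal.sub_le_iff_le_add (Or.inl hbot) (Or.inl htop')).1 h1

/-- A function with a bounded Bernstein exponent is large near the centre of a ball. -/
theorem exists_sup_and_large_value {f : C2 → ℂ} {v p : C2} {B : ℝ}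
    (hv : v ∈ ball (0 : C2) (1 / 4)) (hf : supLog f 0 1 ≤ 0) (hB : bernsteinSup f (1 / 4) ≤ B)
    (hp : p ∈ ball v (1 / 256)) (hfp : f p ≠ 0) :
    ∃ S : ℝ, 0 < S ∧ S ≤ 1 ∧ (∀ x ∈ ball v (1 / 4), ‖f x‖ ≤ S) ∧
      ∃ q ∈ ball v (1 / 256), S * Real.exp (-(3 * B + 1)) ≤ ‖f q‖ := by
  have hsub1 : ball v (1 / 4) ⊆ ball 0 1 := by
    intro x hx
    rw [mem_ball, dist_eq_norm] at *
    have h2 : ‖x‖ ≤ ‖x - v‖ + ‖v‖ := norm_le_norm_sub_add x v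
    rw [sub_zero] at *
    linarith
  have hle0 : ∀ R : ℝ, R ≤ 1 / 4 → supLog f v R ≤ 0 := fun R hR =>
    (supLog_mono ((ball_subset_ball hR).trans hsub1)).trans hf
  have hreal : ∀ R : ℝ, 1 / 256 ≤ R → R ≤ 1 / 4 → ∃ M : ℝ, supLog f v R = M := by
    intro R hR1 hR2
    have h1 := log_enorm_le_supLog (f := f) (ball_subset_ball hR1 hp)
    rw [log_enorm_of_ne_zero hfp] at h1
    refine ⟨(supLog f v R).toReal, (EReal.coe_toReal ?_ ?_).symm⟩
    · intro h
      have := hle0 R hR2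
      rw [h, top_le_iff] at this
      exact EReal.zero_ne_top this
    · intro h
      rw [h, le_bot_iff] at h1
      exact EReal.coe_ne_bot _ h1
  -- Three quarterings lead from `1 / 4` to `1 / 256` and cost `3 * B`. The nonzero value at `p`
  -- keeps all these suprema finite.
  obtain ⟨M₁, hM₁⟩ := hreal (1 / 4) (by norm_num) (by norm_num)
  obtain ⟨M₂, hM₂⟩ := hreal (1 / 16) (by norm_num) (by norm_num)
  obtain ⟨M₃, hM₃⟩ := hreal (1 / 64) (by norm_num) (by norm_num)
  obtain ⟨M₄, hM₄⟩ := hreal (1 / 256) (by norm_num) (by norm_num)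
  have step : ∀ (R M M' : ℝ), 1 / 64 ≤ R → R ≤ 1 / 4 → supLog f v R = M →
      supLog f v (R / 4) = M' → M ≤ B + M' := by
    intro R M M' hR1 hR2 h1 h2
    have h3 := supLog_le_supLog_quarter hv ⟨by linarith, hR2⟩ hB
      (ball_subset_ball (by linarith) hp) hfp (hle0 R hR2)
    rw [h1, h2, ← EReal.coe_add, EReal.coe_le_coe_iff] at h3
    exact h3
  have s1 := step (1 / 4) M₁ M₂ (by norm_num) (by norm_num) hM₁
    (by norm_num; norm_num at hM₂; exact hM₂)
  have s2 := step (1 / 16) M₂ M₃ (by norm_num) (by norm_num) hM₂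
    (by norm_num; norm_num at hM₃; exact hM₃)
  have s3 := step (1 / 64) M₃ M₄ (by norm_num) (by norm_num) hM₃
    (by norm_num; norm_num at hM₄; exact hM₄)
  refine ⟨Real.exp M₁, Real.exp_pos _, ?_, fun x hx => norm_le_exp_of_supLog_le hM₁.le hx, ?_⟩
  · rw [Real.exp_le_one_iff]
    have := hle0 (1 / 4) le_rfl
    rw [hM₁] at this
    exact_mod_cast this
  -- The supremum need not be attained on the open ball, hence the extra `1`.
  · have h1 : ((M₄ - 1 : ℝ) : EReal) < supLog f v (1 / 256) := by
      rw [hM₄, EReal.coe_lt_coe_iff]; linarith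
    unfold supLog at h1
    obtain ⟨q, hq⟩ := lt_iSup_iff.1 h1
    obtain ⟨hqm, hq⟩ := lt_iSup_iff.1 hq
    refine ⟨q, hqm, ?_⟩
    have hfq : f q ≠ 0 := by
      intro h
      rw [h] at hq
      simp at hq
    rw [log_enorm_of_ne_zero hfq, EReal.coe_lt_coe_iff,
      Real.lt_log_iff_exp_lt (norm_pos_iff.2 hfq)] at hq
    rw [← Real.exp_add]
    exact (Real.exp_le_exp.2 (by linarith)).trans hq.le

/-! ### Adapted coordinates and numerical thresholds. -/

/-- Every vector is a multiple of the first vector of some orthonormal basis. -/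
theorem exists_orthonormalBasis_smul_eq (y : C2) :
    ∃ (b : OrthonormalBasis (Fin 2) ℂ C2) (a : ℂ), y = a • b 0 ∧ ‖a‖ = ‖y‖ := by
  by_cases hy : y = 0
  · exact ⟨EuclideanSpace.basisFun _ _, 0, by simp [hy], by simp [hy]⟩
  · have hy0 : ‖y‖ ≠ 0 := norm_ne_zero_iff.2 hy
    obtain ⟨b, hb⟩ := Orthonormal.exists_orthonormalBasis_extension_of_card_eq (𝕜 := ℂ) (E := C2)
      (ι := Fin 2) (by simp) (v := fun _ => ((‖y‖ : ℂ)⁻¹) • y) (s := {0}) (by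
        constructor
        · intro i
          simp [norm_smul, hy0]
        · intro i j hij
          exact absurd (Subsingleton.elim i j) hij)
    refine ⟨b, ‖y‖, ?_, by simp⟩
    rw [hb 0 rfl, smul_smul, mul_inv_cancel₀ (by exact_mod_cast hy0), one_smul]

theorem sixty_eight_le_exp_five : (68 : ℝ) ≤ Real.exp 5 := by
  have h5 : Real.exp 5 = Real.exp 1 ^ 5 := by rw [← Real.exp_nat_mul]; norm_num
  rw [h5]
  calc (68 : ℝ) ≤ 2.7 ^ 5 := by norm_num
    _ ≤ _ := by gcongr; linarith [Real.exp_one_gt_d9]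

/-- The small balls are much smaller than the polydisc on which the resultant is defined. -/
theorem scale_separation {B H₁ K₁ s t : ℝ} (hB : 1 ≤ B) (hH₁ : 10 ^ 6 * B ≤ H₁) (hK : 1 ≤ K₁)
    (hlog : 10 ^ 6 * Real.log K₁ ≤ H₁) (hs : s = Real.exp (-(11 * (3 * B + 1))) / 64)
    (ht : t = 4 * K₁ * Real.exp (-H₁)) :
    17 * t < s ∧ H₁ / 4 ≤ Real.log ((s - 8 * t) / (9 * t)) := by
  have ht0 : 0 < t := by rw [ht]; positivity
  have hKe : K₁ ≤ Real.exp (H₁ / 8) := by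
    rw [← Real.log_le_iff_le_exp (by linarith)]
    have := Real.log_nonneg hK
    linarith
  have he := sixty_eight_le_exp_five
  have key : 17 * t * Real.exp (H₁ / 4) ≤ s := by
    calc 17 * t * Real.exp (H₁ / 4) = 68 * K₁ * Real.exp (-H₁) * Real.exp (H₁ / 4) := by
          rw [ht]; ring
      _ ≤ Real.exp 5 * Real.exp (H₁ / 8) * Real.exp (-H₁) * Real.exp (H₁ / 4) := by gcongr
      _ = Real.exp (5 + H₁ / 8 - H₁ + H₁ / 4) := by simp only [← Real.exp_add]; ring_nf
      _ ≤ Real.exp (-(11 * (3 * B + 1)) - 5) := by rw [Real.exp_le_exp]; linarith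
      _ = Real.exp (-(11 * (3 * B + 1))) / Real.exp 5 := Real.exp_sub _ _
      _ ≤ s := by rw [hs]; gcongr; linarith
  have h1 : 1 < Real.exp (H₁ / 4) := by rw [Real.one_lt_exp_iff]; linarith
  have h2 : 17 * t < s := by nlinarith
  refine ⟨h2, ?_⟩
  rw [Real.le_log_iff_exp_le (div_pos (by linarith) (by linarith)), le_div_iff₀ (by linarith)]
  nlinarith

/-- The smallness required by the resultant argument. -/
theorem exp_lt_resultant_threshold {B H H₀ H₁ m η : ℝ} {n d : ℕ} (hB : 1 ≤ B)
    (hH : 10 ^ 6 ≤ H) (hH₁ : 10 ^ 6 * B ≤ H₁) (hH₀ : 10 ^ 6 * H₁ ≤ H₀)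
    (hm : Real.exp (-(2 * H₀)) ≤ m)
    (hη : η = Real.exp (-(11 * (3 * B + 1))) / 64 * Real.exp (-H) / 8)
    (hd : (d : ℝ) ≤ 12 * (3 * B + 1)) (hn : n * H₁ ≤ 768 * B * H₀) :
    Real.exp (-(H * B ^ 2 * H₀)) < m * (Real.exp (-(6 * (192 * B * H₀))) * η ^ n / 64) ^ d := by
  have he := sixty_eight_le_exp_five
  have hη0 : Real.exp (-(54 * B + H)) ≤ η := by
    have h8 : (512 : ℝ) ≤ Real.exp 10 := by
      have : Real.exp 10 = Real.exp 5 * Real.exp 5 := by rw [← Real.exp_add]; norm_num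
      rw [this]
      nlinarith
    calc Real.exp (-(54 * B + H))
        ≤ Real.exp (-(11 * (3 * B + 1))) * Real.exp (-H) / Real.exp 10 := by
          rw [← Real.exp_add, ← Real.exp_sub, Real.exp_le_exp]; linarith
      _ ≤ Real.exp (-(11 * (3 * B + 1))) * Real.exp (-H) / 512 := by gcongr
      _ = η := by rw [hη]; ring
  have hη1 : 0 < η := (Real.exp_pos _).trans_le hη0
  have hm0 : 0 ≤ m := (Real.exp_pos _).le.trans hm
  have hn0 : (0 : ℝ) ≤ n := n.cast_nonneg
  have hd0 : (0 : ℝ) ≤ d := d.cast_nonneg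
  have hX : Real.exp (-(1152 * B * H₀ + n * (54 * B + H) + 5)) ≤
      Real.exp (-(6 * (192 * B * H₀))) * η ^ n / 64 := by
    calc Real.exp (-(1152 * B * H₀ + n * (54 * B + H) + 5))
        = Real.exp (-(6 * (192 * B * H₀))) * Real.exp (-(54 * B + H)) ^ n / Real.exp 5 := by
          rw [← Real.exp_nat_mul, ← Real.exp_add, ← Real.exp_sub]; ring_nf
      _ ≤ Real.exp (-(6 * (192 * B * H₀))) * η ^ n / 64 := by
        gcongr
        linarith
  have hnB : (n : ℝ) * (10 ^ 6 * B) ≤ 768 * B * H₀ := le_trans (by gcongr) hn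
  -- Here `H₁ ≥ 10 ^ 6 * B` cancels the factor `B`. With `d = O(B)`, the cost `d * n * (54 * B + H)`
  -- is then `O(B ^ 2 * H₀)` plus a small multiple of `B * H₀ * H`, which `H * B ^ 2 * H₀` absorbs.
  have hn' : (n : ℝ) ≤ 768 / 10 ^ 6 * H₀ := by
    have h1 : (n * 10 ^ 6) * B ≤ (768 * H₀) * B := by linarith
    have h2 := le_of_mul_le_mul_right h1 (by linarith)
    linarith
  have hd' : (d : ℝ) ≤ 48 * B := by linarith
  have hH₀0 : 10 ^ 12 * B ≤ H₀ := by linarith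
  have hsum : 1152 * B * H₀ + n * (54 * B + H) + 5 ≤ 1158 * B * H₀ + 1 / 1000 * H₀ * H := by
    have h1 : n * (54 * B + H) ≤ 768 / 10 ^ 6 * H₀ * (54 * B + H) := by gcongr
    have h2 : 1 * 10 ^ 12 ≤ B * H₀ := by
      have : (10 : ℝ) ^ 12 ≤ H₀ := by linarith
      gcongr
    have h3 : 0 ≤ H₀ * H := by
      apply mul_nonneg <;> linarith
    nlinarith
  have hpow : 2 * H₀ + d * (1152 * B * H₀ + n * (54 * B + H) + 5) < H * B ^ 2 * H₀ := by
    have h0 : 0 ≤ 1158 * B * H₀ + 1 / 1000 * H₀ * H := by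
      have : 0 ≤ H₀ := by linarith
      positivity
    have h1 : d * (1152 * B * H₀ + n * (54 * B + H) + 5) ≤
        48 * B * (1158 * B * H₀ + 1 / 1000 * H₀ * H) := by
      refine (mul_le_mul_of_nonneg_left hsum hd0).trans ?_
      gcongr
    have hH₀p : 0 < H₀ := by linarith
    have hB2 : 1 ≤ B ^ 2 := one_le_pow₀ hB
    have h2 : 2 + 48 * 1158 * B ^ 2 + 48 / 1000 * B * H < H * B ^ 2 := by
      have h3 : B * H ≤ B ^ 2 * H := by
        have : 0 ≤ H := by linarith
        gcongr
        nlinarith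
      have h4 : B ^ 2 * 10 ^ 6 ≤ B ^ 2 * H := by gcongr
      nlinarith
    have h5 := mul_lt_mul_of_pos_right h2 hH₀p
    nlinarith
  calc Real.exp (-(H * B ^ 2 * H₀))
      < Real.exp (-(2 * H₀) + d * -(1152 * B * H₀ + n * (54 * B + H) + 5)) := by
        rw [Real.exp_lt_exp]; linarith
    _ = Real.exp (-(2 * H₀)) * Real.exp (-(1152 * B * H₀ + n * (54 * B + H) + 5)) ^ d := by
        rw [Real.exp_add, Real.exp_nat_mul]
    _ ≤ _ := by gcongr

theorem norm_repr_apply_le (b : OrthonormalBasis (Fin 2) ℂ C2) (x : C2) (i : Fin 2) :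
    ‖b.repr x i‖ ≤ ‖x‖ :=
  (PiLp.norm_apply_le _ i).trans_eq (b.repr.norm_map x)

theorem norm_combination_le (b : OrthonormalBasis (Fin 2) ℂ C2) (w z : ℂ) :
    ‖w • b 0 + z • b 1‖ ≤ ‖w‖ + ‖z‖ := by
  refine (norm_add_le _ _).trans ?_
  simp [norm_smul]

theorem repr_combination (b : OrthonormalBasis (Fin 2) ℂ C2) (w z : ℂ) :
    b.repr (w • b 0 + z • b 1) 0 = w ∧ b.repr (w • b 0 + z • b 1) 1 = z := by
  simp [b.repr_self]

/-! ### The cover near one ball. -/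

/-- A function bounded below on a circle in a line through `v` remains so on nearby lines. -/
theorem norm_ge_of_circle {f : C2 → ℂ} {v : C2} {b : OrthonormalBasis (Fin 2) ℂ C2} {S r a : ℝ}
    (hf : DifferentiableOn ℂ f (ball v (1 / 4))) (hS : ∀ x ∈ ball v (1 / 4), ‖f x‖ ≤ S)
    (ha1 : a ≤ 1) (hr : r ≤ 1 / 64)
    (hcirc : ∀ w : ℂ, ‖w‖ = r → S * a ≤ ‖f (v + w • b 0)‖) {w ξ : ℂ}
    (hw : ‖w‖ = r) (hξ : ‖ξ‖ ≤ a / 32) : S * a / 2 ≤ ‖f (v + (w • b 0 + ξ • b 1))‖ := by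
  have hmem : ∀ x ∈ ball (0 : ℂ) (1 / 8), v + (w • b 0 + x • b 1) ∈ ball v (1 / 4) := by
    intro x hx
    rw [mem_ball_zero_iff] at hx
    rw [mem_ball, dist_eq_norm, add_sub_cancel_left]
    have := norm_combination_le b w x
    linarith
  have hdiff : DifferentiableOn ℂ (fun x : ℂ => f (v + (w • b 0 + x • b 1))) (ball 0 (1 / 8)) :=
    hf.comp (by fun_prop) hmem
  have hmaps : MapsTo (fun x : ℂ => f (v + (w • b 0 + x • b 1))) (ball 0 (1 / 8))
      (closedBall (f (v + (w • b 0 + (0 : ℂ) • b 1))) (2 * S)) := by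
    intro x hx
    rw [mem_closedBall, dist_eq_norm]
    refine (norm_sub_le _ _).trans ?_
    linarith [hS _ (hmem x hx), hS _ (hmem 0 (mem_ball_self (by norm_num)))]
  -- By the Schwarz lemma the change is at most `(2 * S / (1 / 8)) * (a / 32) = S * a / 2`.
  have h1 := Complex.dist_le_div_mul_dist_of_mapsTo_ball hdiff hmaps
    (z := ξ) (by rw [mem_ball_zero_iff]; linarith)
  rw [dist_eq_norm, dist_zero_right, zero_smul, add_zero] at h1
  have h2 := hcirc w hw
  have hS0 : 0 ≤ S := (norm_nonneg _).trans (hS _ (hmem 0 (mem_ball_self (by norm_num))))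
  have h3 : 2 * S / (1 / 8) * ‖ξ‖ ≤ 2 * S / (1 / 8) * (a / 32) := by gcongr
  have h4 := norm_sub_norm_le (f (v + w • b 0)) (f (v + (w • b 0 + ξ • b 1)))
  rw [norm_sub_rev] at h4
  linarith

/-- Near a small ball of the transversality condition, one linear coordinate of the points where
both functions are very small lies near one of a controlled number of points. -/
theorem exists_coordinate_cover {f₁ f₂ : C2 → ℂ} {v : C2} {b : OrthonormalBasis (Fin 2) ℂ C2}
    {B H H₀ H₁ K₁ S r s κ : ℝ} {N : ℕ} {c : Fin N → C2} (hB : 1 ≤ B) (hH : 10 ^ 6 ≤ H)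
    (hH₁ : 10 ^ 6 * B ≤ H₁) (hH₀ : 10 ^ 6 * H₁ ≤ H₀) (hK : 1 ≤ K₁)
    (hlog : 10 ^ 6 * Real.log K₁ ≤ H₁) (hN : (N : ℝ) ≤ K₁)
    (hf₁ : AnalyticOnNhd ℂ f₁ (ball 0 1)) (hf₂ : AnalyticOnNhd ℂ f₂ (ball 0 1))
    (hb₂ : ∀ x ∈ ball (0 : C2) 1, ‖f₂ x‖ ≤ 1) (hv : v ∈ ball (0 : C2) (1 / 4))
    (hS0 : 0 < S) (hS1 : S ≤ 1) (hS : ∀ x ∈ ball v (1 / 4), ‖f₁ x‖ ≤ S)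
    (hSlow : Real.exp (-H₀) / 2 ≤ S) (hr1 : 1 / 128 ≤ r) (hr2 : r ≤ 1 / 64)
    (hcirc : ∀ w : ℂ, ‖w‖ = r → S * Real.exp (-(11 * (3 * B + 1))) ≤ ‖f₁ (v + w • b 0)‖)
    (hs : s = Real.exp (-(11 * (3 * B + 1))) / 64) (hκ0 : 0 ≤ κ) (hκs : κ ≤ s)
    (htrans : ∀ x ∈ ball (0 : C2) (1 / 2), (∀ j, x ∉ ball (c j) (Real.exp (-H₁))) → f₁ x = 0 →
      Real.exp (-H₀) ≤ ‖f₂ x‖) :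
    ∃ (n : ℕ) (ζ : Fin n → ℂ), n * H₁ ≤ 768 * B * H₀ ∧
      ∀ x ∈ ball v (2 * Real.exp (-H₁)), ‖f₁ x‖ < Real.exp (-(H * B ^ 2 * H₀)) →
        ‖f₂ x‖ < Real.exp (-(H * B ^ 2 * H₀)) →
        ∃ i, ‖b.repr (x - v) 1 - κ * b.repr (x - v) 0 - ζ i‖ < s * Real.exp (-H) / 8 := by
  set L := 3 * B + 1 with hL
  set t := 4 * K₁ * Real.exp (-H₁) with ht
  have hδ : 0 < Real.exp (-H₁) := Real.exp_pos _
  have ht0 : 0 < t := by positivity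
  have hδt : 4 * Real.exp (-H₁) ≤ t := by rw [ht]; nlinarith
  obtain ⟨hts, hlam⟩ := scale_separation hB hH₁ hK hlog hs ht
  set a := Real.exp (-(11 * L)) with ha
  have ha0 : 0 < a := Real.exp_pos _
  have ha1 : a ≤ 1 := by rw [ha, Real.exp_le_one_iff]; linarith
  have hs64 : s ≤ 1 / 64 := by rw [hs]; linarith
  have hs0 : 0 < s := by rw [hs]; positivity
  have hκn : ‖(κ : ℂ)‖ = κ := by simp [abs_of_nonneg hκ0]
  have hH₀0 : 10 ^ 12 * B ≤ H₀ := by linarith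
  -- Here `w` runs along lines of slope `κ` and `z` labels them; `φ` below recovers `z`, and the
  -- resultant eliminates `w`.
  set P : ℂ × ℂ → C2 := fun p => v + (p.2 • b 0 + (p.1 + κ * p.2) • b 1) with hP
  have hPv : ∀ z w : ℂ, ‖z‖ < s → ‖w‖ < 1 / 8 → P (z, w) ∈ ball v (1 / 4) := by
    intro z w hz hw
    rw [mem_ball, dist_eq_norm, hP, add_sub_cancel_left]
    refine (norm_combination_le b _ _).trans_lt ?_
    have h1 : ‖z + κ * w‖ ≤ ‖z‖ + κ * ‖w‖ := (norm_add_le _ _).trans (by rw [norm_mul, hκn])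
    have h2 : κ * ‖w‖ ≤ 1 / 64 * (1 / 8) := by gcongr; linarith
    linarith
  have hv' : ‖v‖ < 1 / 4 := by simpa using hv
  have hball : ∀ x ∈ ball v (1 / 4), ‖x‖ < 1 / 2 := by
    intro x hx
    rw [mem_ball, dist_eq_norm] at hx
    have := norm_le_norm_sub_add x v
    linarith
  have hball1 : ∀ x ∈ ball v (1 / 4), x ∈ ball (0 : C2) 1 := by
    intro x hx
    rw [mem_ball_zero_iff]
    linarith [hball x hx]
  have hPan : ∀ p, AnalyticAt ℂ P p := by
    intro p
    exact analyticAt_const.add ((analyticAt_snd.smul analyticAt_const).add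
      ((analyticAt_fst.add (analyticAt_const.mul analyticAt_snd)).smul analyticAt_const))
  have hGan : ∀ f : C2 → ℂ, AnalyticOnNhd ℂ f (ball 0 1) → ∀ z w : ℂ, ‖z‖ < s → ‖w‖ < 1 / 8 →
      AnalyticAt ℂ (fun p => f (P p)) (z, w) := fun f hf z w hz hw =>
    (hf _ (hball1 _ (hPv z w hz hw))).comp (hPan _)
  set φ : C2 → ℂ := fun x => b.repr (x - v) 1 - κ * b.repr (x - v) 0 with hφ
  have hφlip : ∀ x y, ‖φ x - φ y‖ ≤ 2 * ‖x - y‖ := by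
    intro x y
    have h1 : φ x - φ y = b.repr (x - y) 1 - κ * b.repr (x - y) 0 := by
      simp only [hφ, map_sub, PiLp.sub_apply]; ring
    rw [h1]
    refine (norm_sub_le _ _).trans ?_
    rw [norm_mul, hκn]
    have h2 := norm_repr_apply_le b (x - y) 0
    have h3 := norm_repr_apply_le b (x - y) 1
    have h4 : κ * ‖b.repr (x - y) 0‖ ≤ 1 * ‖x - y‖ := by gcongr; linarith
    linarith
  have hφP : ∀ z w, φ (P (z, w)) = z := by
    intro z w
    simp only [hφ, hP, add_sub_cancel_left]
    rw [(repr_combination b _ _).1, (repr_combination b _ _).2]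
    ring
  have hPφ : ∀ x, P (φ x, b.repr (x - v) 0) = x := by
    intro x
    simp only [hP, hφ, sub_add_cancel]
    have := b.sum_repr (x - v)
    rw [Fin.sum_univ_two] at this
    rw [this, add_sub_cancel]
  -- Since `k ≤ N ≤ K₁`, the fibre missing all the balls has label at most `t = 4 * K₁ * exp (-H₁)`,
  -- which dictates the choice of `t`.
  obtain ⟨k, hkN, hk⟩ := exists_fibre_avoiding_balls c hδ hφlip
  have hz₀ : ‖((4 * k * Real.exp (-H₁) : ℝ) : ℂ)‖ ≤ t := by
    rw [Complex.norm_real, Real.norm_eq_abs, abs_of_nonneg (by positivity), ht]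
    have : (k : ℝ) ≤ K₁ := le_trans (by exact_mod_cast hkN) hN
    gcongr
  have hL1 : 4 ≤ L := by linarith
  have hL4 : L ≤ 4 * B := by linarith
  have he2 : (4 : ℝ) ≤ Real.exp 2 := by
    have h5 : Real.exp 2 = Real.exp 1 ^ 2 := by rw [← Real.exp_nat_mul]; norm_num
    rw [h5]
    nlinarith [Real.exp_one_gt_d9]
  have hm : Real.exp (-(2 * H₀)) ≤ S * a / 2 := by
    calc Real.exp (-(2 * H₀)) ≤ Real.exp (-H₀) * a / Real.exp 2 := by
          rw [ha, ← Real.exp_add, ← Real.exp_sub, Real.exp_le_exp]; linarith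
      _ ≤ Real.exp (-H₀) * a / 4 := by gcongr
      _ = Real.exp (-H₀) / 2 * a / 2 := by ring
      _ ≤ _ := by gcongr
  -- `m = S * exp (-(11 * L)) / 2`, and one more factor `exp L` absorbs the `2`: hence `D = 12 * L`.
  have hD : S ≤ S * a / 2 * Real.exp (12 * L) := by
    have h1 : a * Real.exp (12 * L) = Real.exp L := by rw [ha, ← Real.exp_add]; ring_nf
    have h2 : Real.exp 2 ≤ Real.exp L := Real.exp_le_exp.2 (by linarith)
    have h3 : S * a / 2 * Real.exp (12 * L) = S * (Real.exp L / 2) := by rw [← h1]; ring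
    rw [h3]
    exact le_mul_of_one_le_right hS0.le (by linarith)
  have hDA : 12 * L * (H₀ + 2 * H₀ + 3 * (12 * L)) ≤ 192 * B * H₀ := by
    calc 12 * L * (H₀ + 2 * H₀ + 3 * (12 * L)) ≤ 12 * (4 * B) * (4 * H₀) := by
          gcongr
          · linarith
          · linarith
      _ = 192 * B * H₀ := by ring
  -- The displacement `z + κ * w` has size at most `2 * s = a / 32`, the range allowed by
  -- `norm_ge_of_circle`.
  have hlow : ∀ z w : ℂ, ‖z‖ < s → ‖w‖ = r → S * a / 2 ≤ ‖f₁ (P (z, w))‖ := by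
    intro z w hz hw
    refine norm_ge_of_circle (fun x hx => (hf₁ x (hball1 x hx)).differentiableAt.differentiableWithinAt)
      hS ha1 hr2 hcirc hw ?_
    refine (norm_add_le _ _).trans ?_
    rw [norm_mul, hκn, hw]
    have : κ * r ≤ s * 1 := by gcongr; linarith
    linarith
  have hH₀p : 0 < H₀ := by linarith
  have htr : ∀ w : ℂ, ‖w‖ < r → f₁ (P ((4 * k * Real.exp (-H₁) : ℝ), w)) = 0 →
      Real.exp (-H₀) ≤ ‖f₂ (P ((4 * k * Real.exp (-H₁) : ℝ), w))‖ := by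
    intro w hw h0
    have hPm := hPv _ w (lt_of_le_of_lt hz₀ (by linarith : t < s)) (by linarith : ‖w‖ < 1 / 8)
    exact htrans _ (by rw [mem_ball_zero_iff]; exact hball _ hPm) (hk _ (hφP _ _)) h0
  obtain ⟨n, d, ζ, hd, hn, hcov⟩ := exists_finite_projection (G₁ := fun p => f₁ (P p))
    (G₂ := fun p => f₂ (P p)) (h := H₀) (μ := 2 * H₀) (D := 12 * L) (A := 192 * B * H₀)
    (m := S * a / 2) (r := r)
    (by linarith : s ≤ 1) ht0 hts (by linarith) hr2 (by positivity) hS1 hm (by linarith)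
    (by linarith) (by positivity) hD hDA (hGan f₁ hf₁) (hGan f₂ hf₂)
    (fun z w hz hw => hS _ (hPv z w hz hw))
    (fun z w hz hw => hb₂ _ (hball1 _ (hPv z w hz hw))) hlow hz₀ htr
  have hnH : n * H₁ ≤ 768 * B * H₀ := by
    have h1 : (n : ℝ) * (H₁ / 4) ≤ n * Real.log ((s - 8 * t) / (9 * t)) := by gcongr
    linarith
  refine ⟨n, ζ, hnH, fun x hx h1 h2 => ?_⟩
  have hthr := exp_lt_resultant_threshold (η := s * Real.exp (-H) / 8) hB hH hH₁ hH₀ hm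
    (by rw [hs]) hd hnH
  rw [mem_ball, dist_eq_norm] at hx
  refine hcov (s * Real.exp (-H) / 8) _ (by positivity) hthr (φ x) (b.repr (x - v) 0) ?_ ?_ ?_ ?_
  · have h3 := hφlip x v
    have h4 : φ v = 0 := by simp [hφ]
    rw [h4, sub_zero] at h3
    linarith
  · have := norm_repr_apply_le b (x - v) 0
    linarith
  · simpa only [hPφ] using h1
  · simpa only [hPφ] using h2

/-- Near a point close to which `f₁` is not too small, the set where `f₁` and `f₂` are both very
small is covered by a controlled number of balls. -/
theorem exists_local_cover {f₁ f₂ : C2 → ℂ} {v p : C2}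
    {B H H₀ H₁ K₁ : ℝ} {N : ℕ} {c : Fin N → C2} (hB : 1 ≤ B) (hH : 10 ^ 6 ≤ H)
    (hH₁ : 10 ^ 6 * B ≤ H₁) (hH₀ : 10 ^ 6 * H₁ ≤ H₀) (hK : 1 ≤ K₁)
    (hlog : 10 ^ 6 * Real.log K₁ ≤ H₁) (hN : (N : ℝ) ≤ K₁)
    (hf₁ : AnalyticOnNhd ℂ f₁ (ball 0 1)) (hf₂ : AnalyticOnNhd ℂ f₂ (ball 0 1))
    (hn₁ : supLog f₁ 0 1 ≤ 0) (hb₂ : ∀ x ∈ ball (0 : C2) 1, ‖f₂ x‖ ≤ 1)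
    (hbern : bernsteinSup f₁ (1 / 4) ≤ B) (hv : v ∈ ball (0 : C2) (1 / 4))
    (hp : p ∈ ball v (1 / 256)) (hfp : Real.exp (-H₀) / 2 ≤ ‖f₁ p‖)
    (htrans : ∀ x ∈ ball (0 : C2) (1 / 2), (∀ j, x ∉ ball (c j) (Real.exp (-H₁))) → f₁ x = 0 →
      Real.exp (-H₀) ≤ ‖f₂ x‖) :
    ∃ T : Finset C2, (T.card : ℝ) ≤ B ^ 2 * H₀ ^ 2 ∧
      ∀ x ∈ ball v (2 * Real.exp (-H₁)), ‖f₁ x‖ < Real.exp (-(H * B ^ 2 * H₀)) →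
        ‖f₂ x‖ < Real.exp (-(H * B ^ 2 * H₀)) → ∃ y ∈ T, x ∈ ball y (Real.exp (-H)) := by
  classical
  have hfp0 : f₁ p ≠ 0 := by
    rw [← norm_pos_iff]
    exact lt_of_lt_of_le (by positivity) hfp
  obtain ⟨S, hS0, hS1, hS, q, hq, hSq⟩ := exists_sup_and_large_value hv hn₁ hbern hp hfp0
  have hSlow : Real.exp (-H₀) / 2 ≤ S :=
    hfp.trans (hS p (ball_subset_ball (by norm_num) hp))
  -- The first basis vector points towards `q`, so the line `v + ℂ • b 0` contains the large value.
  obtain ⟨b, a, hqa, hna⟩ := exists_orthonormalBasis_smul_eq (q - v)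
  have ha : ‖a‖ ≤ 1 / 256 := by
    rw [hna, ← dist_eq_norm]
    exact (mem_ball.1 hq).le
  have hmem : ∀ w ∈ ball (0 : ℂ) (1 / 4), v + w • b 0 ∈ ball v (1 / 4) := by
    intro w hw
    rw [mem_ball, dist_eq_norm, add_sub_cancel_left, norm_smul]
    simpa using hw
  have hv1 : ball v (1 / 4) ⊆ ball 0 1 := by
    apply ball_subset_ball'
    rw [mem_ball] at hv
    linarith
  obtain ⟨r, hr, hcirc⟩ := exists_circle_norm_ge (g := fun w => f₁ (v + w • b 0)) (a := a)
    (L := 3 * B + 1) hS0 (by linarith)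
    (DifferentiableOn.comp (t := ball v (1 / 4))
      (fun x hx => (hf₁ x (hv1 hx)).differentiableAt.differentiableWithinAt) (by fun_prop) hmem)
    (fun w hw => hS _ (hmem w hw)) ha (by rw [← hqa, add_sub_cancel]; exact hSq)
  set s := Real.exp (-(11 * (3 * B + 1))) / 64 with hs
  have hs0 : 0 < s := by positivity
  have hs1 : s ≤ 1 := by
    have : Real.exp (-(11 * (3 * B + 1))) ≤ 1 := by rw [Real.exp_le_one_iff]; linarith
    linarith
  -- In the coordinates `(W, Y)` of `x - v`, slope `0` locates `Y` and slope `s` locates `Y - s *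
  -- W`.
  obtain ⟨n, ζ, hn, hζ⟩ := exists_coordinate_cover (κ := 0) hB hH hH₁ hH₀ hK hlog hN hf₁ hf₂ hb₂
    hv hS0 hS1 hS hSlow hr.1 hr.2 hcirc hs le_rfl hs0.le htrans
  obtain ⟨n', ζ', hn', hζ'⟩ := exists_coordinate_cover (κ := s) hB hH hH₁ hH₀ hK hlog hN hf₁ hf₂
    hb₂ hv hS0 hS1 hS hSlow hr.1 hr.2 hcirc hs hs0.le le_rfl htrans
  have hcount : ∀ n : ℕ, (n : ℝ) * H₁ ≤ 768 * B * H₀ → (n : ℝ) ≤ B * H₀ := by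
    intro n hn
    have h1 : (n : ℝ) * 768 ≤ n * H₁ := by gcongr; linarith
    linarith
  -- Solving for `W` divides by `s`, which is why the coordinates are located to within `s * exp
  -- (-H) / 8`.
  refine ⟨(Finset.univ : Finset (Fin n × Fin n')).image fun ij =>
    v + (((ζ ij.1 - ζ' ij.2) / s) • b 0 + ζ ij.1 • b 1), ?_, fun x hx h1 h2 => ?_⟩
  · have h1 : (((Finset.univ : Finset (Fin n × Fin n')).image fun ij =>
        v + (((ζ ij.1 - ζ' ij.2) / s) • b 0 + ζ ij.1 • b 1)).card : ℝ) ≤ (n : ℝ) * n' := by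
      refine (Nat.cast_le.2 Finset.card_image_le).trans ?_
      simp
    refine h1.trans ?_
    have hBH : 0 ≤ B * H₀ := n.cast_nonneg.trans (hcount n hn)
    calc (n : ℝ) * n' ≤ (B * H₀) * (B * H₀) := by
          gcongr
          · exact hcount n hn
          · exact hcount n' hn'
      _ = _ := by ring
  · obtain ⟨i, hi⟩ := hζ x hx h1 h2
    obtain ⟨j, hj⟩ := hζ' x hx h1 h2
    refine ⟨_, Finset.mem_image_of_mem _ (Finset.mem_univ (i, j)), ?_⟩
    set W := b.repr (x - v) 0 with hW
    set Y := b.repr (x - v) 1 with hY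
    have he : 0 < Real.exp (-H) := Real.exp_pos _
    rw [Complex.ofReal_zero, zero_mul, sub_zero] at hi
    have hxv : x - v = W • b 0 + Y • b 1 := by
      have := b.sum_repr (x - v)
      rw [Fin.sum_univ_two] at this
      exact this.symm
    have hdiff : x - (v + (((ζ i - ζ' j) / s) • b 0 + ζ i • b 1)) =
        (W - (ζ i - ζ' j) / s) • b 0 + (Y - ζ i) • b 1 := by
      rw [← sub_sub, hxv, sub_smul, sub_smul]
      abel
    have hs0' : (s : ℂ) ≠ 0 := by exact_mod_cast hs0.ne'
    have hWs : ‖W - (ζ i - ζ' j) / s‖ * s < s * Real.exp (-H) / 4 := by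
      have h3 : (W - (ζ i - ζ' j) / s) * s = (Y - ζ i) - (Y - s * W - ζ' j) := by
        field_simp
        ring
      have h4 : ‖(W - (ζ i - ζ' j) / s) * s‖ = ‖W - (ζ i - ζ' j) / s‖ * s := by
        rw [norm_mul, Complex.norm_real, Real.norm_eq_abs, abs_of_pos hs0]
      rw [← h4, h3]
      refine (norm_sub_le _ _).trans_lt ?_
      linarith
    have hW' : ‖W - (ζ i - ζ' j) / s‖ < Real.exp (-H) / 4 := by
      have h5 : s * Real.exp (-H) / 4 = Real.exp (-H) / 4 * s := by ring
      rw [h5] at hWs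
      exact lt_of_mul_lt_mul_right hWs hs0.le
    have hse : s * Real.exp (-H) ≤ Real.exp (-H) := mul_le_of_le_one_left he.le hs1
    rw [mem_ball, dist_eq_norm, hdiff]
    refine (norm_combination_le b _ _).trans_lt ?_
    linarith

/-! ### Assembly over all the balls. -/

theorem norm_pair_le (a b : ℂ) : ‖(!₂[a, b] : C2)‖ ≤ ‖a‖ + ‖b‖ := by
  rw [EuclideanSpace.norm_eq, Fin.sum_univ_two]
  apply Real.sqrt_le_iff.2
  refine ⟨by positivity, ?_⟩
  simp
  nlinarith [norm_nonneg a, norm_nonneg b]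

theorem IsCar20.of_finset {H K : ℝ} {S : Set C2} (T : Finset C2) (hH : 0 ≤ H) (hK : 1 ≤ K)
    (hT : (T.card : ℝ) ≤ K) (hS : ∀ x ∈ S, ∃ y ∈ T, x ∈ ball y (Real.exp (-H))) :
    IsCar20 H K S := by
  refine ⟨hH, hK, T.card, fun i => T.equivFin.symm i, hT, fun x hx => ?_⟩
  obtain ⟨y, hy, hxy⟩ := hS x hx
  exact mem_iUnion.2 ⟨T.equivFin ⟨y, hy⟩, by simpa using hxy⟩

theorem theoremC :
    ∃ C : ℝ, 1 ≤ C ∧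
      ∀ (f₁ f₂ : C2 → ℂ) (B₀ H₀ H₁ K₁ : ℝ), Transversal C f₁ f₂ B₀ H₀ H₁ K₁ → 1 ≤ B₀ →
        ∀ H : ℝ, C ≤ H →
          ∃ K : ℝ, K ≤ C * (K₁ * B₀ ^ 2 * H₀ ^ 2) ∧
            IsCar20 H K
              (smallSet f₁ f₂ (Real.exp (-(H * B₀ ^ 2 * H₀))) ∩ Metric.ball 0 (1 / 4)) := by
  classical
  refine ⟨10 ^ 6, by norm_num, fun f₁ f₂ B H₀ H₁ K₁ hT hB H hH =>
    ⟨10 ^ 6 * (K₁ * B ^ 2 * H₀ ^ 2), le_rfl, ?_⟩⟩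
  obtain ⟨hf₁, hf₂, hn₁, hn₂, hbern, hH₁, hH₀, hlog, -, hK, N, c, hN, hcov⟩ := hT
  have hB₁ : bernsteinSup f₁ (1 / 4) ≤ B := by rw [hbern]; exact le_max_left _ _
  have hB₂ : bernsteinSup f₂ (1 / 4) ≤ B := by rw [hbern]; exact le_max_right _ _
  have hb : ∀ f : C2 → ℂ, supLog f 0 1 ≤ 0 → ∀ x ∈ ball (0 : C2) 1, ‖f x‖ ≤ 1 := by
    intro f hf x hx
    have := norm_le_exp_of_supLog_le (M := 0) (by simpa using hf) hx
    simpa using this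
  have hH₀1 : 1 ≤ H₀ := by linarith
  have hB2 : 1 ≤ B ^ 2 := one_le_pow₀ hB
  have hlarge : ∀ x ∈ ball (0 : C2) (1 / 2), (∀ j, x ∉ ball (c j) (Real.exp (-H₁))) →
      Real.exp (-H₀) ≤ ‖(!₂[f₁ x, f₂ x] : C2)‖ := by
    intro x hx hxc
    by_contra! hlt
    obtain ⟨j, hj⟩ := mem_iUnion.1 (hcov ⟨⟨ball_subset_ball (by norm_num) hx, hlt⟩, hx⟩)
    exact hxc j hj
  have hεle : Real.exp (-(H * B ^ 2 * H₀)) ≤ Real.exp (-H₀) := by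
    rw [Real.exp_le_exp, neg_le_neg_iff]
    have h1 : 1 ≤ H * B ^ 2 := one_le_mul_of_one_le_of_one_le (by linarith) hB2
    nlinarith
  have hlocal : ∀ j, ∃ T : Finset C2, (T.card : ℝ) ≤ B ^ 2 * H₀ ^ 2 ∧
      ∀ x ∈ smallSet f₁ f₂ (Real.exp (-(H * B ^ 2 * H₀))) ∩ ball 0 (1 / 4),
        x ∈ ball (c j) (Real.exp (-H₁)) → ∃ y ∈ T, x ∈ ball y (Real.exp (-H)) := by
    intro j
    by_cases hne : ∃ v ∈ smallSet f₁ f₂ (Real.exp (-(H * B ^ 2 * H₀))) ∩ ball 0 (1 / 4),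
        v ∈ ball (c j) (Real.exp (-H₁))
    -- The centre `c j` may lie outside `ball 0 (1 / 4)`, where the Bernstein bound says nothing;
    -- recentring at `v` doubles the radius.
    · obtain ⟨v, ⟨-, hv⟩, hvj⟩ := hne
      have hcomp : ∀ x ∈ smallSet f₁ f₂ (Real.exp (-(H * B ^ 2 * H₀))),
          x ∈ ball (c j) (Real.exp (-H₁)) → x ∈ ball v (2 * Real.exp (-H₁)) ∧
            ‖f₁ x‖ < Real.exp (-(H * B ^ 2 * H₀)) ∧ ‖f₂ x‖ < Real.exp (-(H * B ^ 2 * H₀)) := by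
        rintro x ⟨-, hx⟩ hxj
        refine ⟨?_, ?_, ?_⟩
        · rw [mem_ball] at *
          linarith [dist_triangle_right x v (c j)]
        · exact (PiLp.norm_apply_le (!₂[f₁ x, f₂ x] : C2) 0).trans_lt hx
        · exact (PiLp.norm_apply_le (!₂[f₁ x, f₂ x] : C2) 1).trans_lt hx
      obtain ⟨k, hkN, hk⟩ := exists_fibre_avoiding_balls c (Real.exp_pos (-H₁))
        (φ := fun x => (x - v) 0) (fun x y => by
          have h1 := PiLp.norm_apply_le (x - y) 0
          have h2 : (x - v) 0 - (y - v) 0 = (x - y) 0 := by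
            simp only [PiLp.sub_apply]; ring
          rw [h2]
          linarith [norm_nonneg (x - y)])
      set p : C2 := v + EuclideanSpace.single 0 ((4 * k * Real.exp (-H₁) : ℝ) : ℂ) with hp
      have hpv : p ∈ ball v (1 / 256) := by
        rw [mem_ball, dist_eq_norm, hp, add_sub_cancel_left, PiLp.norm_single,
          Complex.norm_real, Real.norm_eq_abs, abs_of_nonneg (by positivity)]
        have h1 := (scale_separation hB hH₁ hK hlog rfl rfl).1
        have h2 : (k : ℝ) ≤ K₁ := le_trans (by exact_mod_cast hkN) hN
        have h3 : 4 * k * Real.exp (-H₁) ≤ 4 * K₁ * Real.exp (-H₁) := by gcongr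
        have h4 : Real.exp (-(11 * (3 * B + 1))) ≤ 1 := by rw [Real.exp_le_one_iff]; linarith
        linarith
      have hp2 : p ∈ ball (0 : C2) (1 / 2) := by
        rw [mem_ball] at *
        linarith [dist_triangle p v 0]
      have hFp := (hlarge p hp2 (hk p (by simp [hp]))).trans (norm_pair_le _ _)
      -- The Bernstein bounds and transversality are symmetric in the two functions, so whichever is
      -- larger at `p` plays the role of `f₁`.
      have hcase : Real.exp (-H₀) / 2 ≤ ‖f₁ p‖ ∨ Real.exp (-H₀) / 2 ≤ ‖f₂ p‖ := by
        by_contra! h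
        linarith [h.1, h.2]
      rcases hcase with h | h
      · obtain ⟨T, hT, hTc⟩ := exists_local_cover hB hH hH₁ hH₀ hK hlog hN hf₁ hf₂ hn₁
          (hb f₂ hn₂) hB₁ hv hpv h fun x hx hxc hx0 => by
            have := (hlarge x hx hxc).trans (norm_pair_le _ _)
            rwa [hx0, norm_zero, zero_add] at this
        refine ⟨T, hT, fun x hx hxj => ?_⟩
        obtain ⟨h1, h2, h3⟩ := hcomp x hx.1 hxj
        exact hTc x h1 h2 h3
      · obtain ⟨T, hT, hTc⟩ := exists_local_cover hB hH hH₁ hH₀ hK hlog hN hf₂ hf₁ hn₂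
          (hb f₁ hn₁) hB₂ hv hpv h fun x hx hxc hx0 => by
            have := (hlarge x hx hxc).trans (norm_pair_le _ _)
            rwa [hx0, norm_zero, add_zero] at this
        refine ⟨T, hT, fun x hx hxj => ?_⟩
        obtain ⟨h1, h2, h3⟩ := hcomp x hx.1 hxj
        exact hTc x h1 h3 h2
    · exact ⟨∅, by simp only [Finset.card_empty, Nat.cast_zero]; positivity,
        fun x hx hxj => absurd ⟨x, hx, hxj⟩ hne⟩
  choose T hTcard hTcov using hlocal
  have hBH : 1 ≤ B ^ 2 * H₀ ^ 2 := one_le_mul_of_one_le_of_one_le hB2 (one_le_pow₀ hH₀1)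
  have hKBH : 1 ≤ K₁ * (B ^ 2 * H₀ ^ 2) := one_le_mul_of_one_le_of_one_le hK hBH
  refine IsCar20.of_finset (Finset.univ.biUnion T) (by linarith) (by linarith) ?_ fun x hx => ?_
  · have h1 : ((Finset.univ.biUnion T).card : ℝ) ≤ ∑ j, ((T j).card : ℝ) := by
      exact_mod_cast Finset.card_biUnion_le
    have h2 : ∑ j, ((T j).card : ℝ) ≤ N * (B ^ 2 * H₀ ^ 2) := by
      calc ∑ j, ((T j).card : ℝ) ≤ ∑ _j : Fin N, B ^ 2 * H₀ ^ 2 :=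
            Finset.sum_le_sum fun j _ => hTcard j
        _ = _ := by simp
    have h3 : N * (B ^ 2 * H₀ ^ 2) ≤ K₁ * (B ^ 2 * H₀ ^ 2) := by gcongr
    linarith
  · obtain ⟨j, hj⟩ := mem_iUnion.1 (hcov ⟨⟨hx.1.1, hx.1.2.trans_le hεle⟩,
      ball_subset_ball (by norm_num) hx.2⟩)
    obtain ⟨y, hy, hxy⟩ := hTcov j x hx hj
    exact ⟨y, Finset.mem_biUnion.2 ⟨j, Finset.mem_univ _, hy⟩, hxy⟩
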